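/- **Common prefix theorem (bitcoin backbone protocol, continuous time).** *Model.* Fix reals $\alpha>\tfrac12$, $\beta\ge 0$, $\Delta>0$ and $0<\delta<\tfrac{40}{81}$, put $g=e^{-\alpha\Delta}$, and assume $\beta<(1-\tfrac{81}{40}\delta)g^2\alpha$. Blocks are numbered $0,1,2,\dots$ in the order in which they are mined. Block $0$ (genesis) is honest and mined at time $0$; block $k\ge1$ is mined at time $T_k>0$, is either honest or adversarial, has a parent block $f_k\in\{0,\dots,k-1\}$, and is published at a time $P_k\in[T_k,\infty]$; only finitely many blocks are mined by any given time. *Blockchain $k$* is the sequence $(b_0,\dots,b_n)$ with $b_0=0$, $b_n=k$ and $f_{b_i}=b_{i-1}$; its *height* is $n$; it is published by time $t$ if all its blocks are. For $0\le j\le n$ its *$j$-deep prefix* is blockchain $b_{n-j}$, that is, $(b_0,\dots,b_{n-j})$. A blockchain is *extended* by the blockchains of which it is an initial segment. A blockchain is *$t$-credible* if it is published by time $t$ and is no shorter than any blockchain published by time $t-\Delta$. A sequence of blocks is *permanent after $t$* if every $r$-credible blockchain with $r\ge t$ extends it. Every honest block $k$ is published when it is mined ($P_k=T_k$), and if $k\geq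 1$, its parent blockchain $f_k$ is $T_k$-credible. All of this is random, with the times $T_k$ and the types (honest or adversarial) of the blocks measurable. For $0\le s<t$ let $N_{s,t}$ and $Z_{s,t}$ be the numbers of honest and of adversarial blocks mined during $(s,t]$. The honest mining process $(N_{0,t})_{t\ge0}$ is a homogeneous Poisson process of rate $\alpha$. For all $0\le s<t$ and all integers $n\ge0$, $$\Pr(Z_{s,t}\le n)\ \ge\ e^{-\beta(t-s)}\sum_{i=0}^{n}\frac{(\beta(t-s))^i}{i!}.$$ Nothing else is assumed about the adversary, the network, or the joint law of the two mining processes. *Typical events.* A *lagger* is an honest block $k$ that is the only honest block mined during $[T_k-\Delta,T_k]$; it is a *loner* if it is also the only honest block mined during $[T_k,T_k+\Delta]$. Let $X_{s,t}$ and $Y_{s,t}$ be the numbers of laggers and of loners mined during $(s,t]$. The good event $E^\delta[s,t]$ is the event that $$(1-\delta)(t-s)\alpha<N_{s,t}<(1+\delta)(t-s)\alpha,\qquad X_{s,t}>(1-\delta)(t-s)g\alpha,$$ $$Y_{s,t}>(1-\delta)(t-s)g^2\alpha,\qquad Z_{s,t}<(t-s)\beta+(t-s)g^2\alpha\delta,$$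 and the typical event is $G^\delta[s,t]=\bigcap_{a\in[0,s],\,b\in[t,\infty)}E^\delta[a,b]$. Put $$\eta=\delta^2g^2\alpha,\qquad \mu=\frac{9e^{\frac{2}{27}\eta}}{\left(1-e^{-\frac1{27}\eta}\right)^2}.$$ *Theorem.* Suppose that the positive integer $k$ and the real number $t$ satisfy $$k\ge\frac{160\,\alpha(1+\Delta)}{\delta},\qquad t\ge\frac{k}{(1-\frac{41}{40}\delta)\,g\,\alpha}.$$ 1. On the event $G^\delta[t-\frac{k}{2\alpha}+\Delta,\ t-\Delta]$, every $t$-credible blockchain has height at least $k-1$, and its $(k-1)$-deep prefix is extended by all $r$-credible blockchains, for all $r\ge t$. 2. Consequently, with probability at least $1-\mu e^{-\frac{\eta}{27}\left(\frac{k}{2\alpha}-2\Delta\right)}$, the $(k-1)$-deep prefix of every $t$-credible blockchain exists and is permanent after $t$ (that is, there is a measurable event of at least this probability on which this holds). -/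

import Mathlib

open MeasureTheory ProbabilityTheory Filter Set
open scoped NNReal

/-- One outcome of the whole system, from time `0` to eternity. Blocks are numbered `0, 1, 2, …` in
the order in which they are mined, ties being broken in some way; block `0` is the honest genesis
block, mined at time `0`. -/
structure BlockTree where
  /-- `time k` is the time at which block `k` is mined -/
  time : ℕ → ℝ
  /-- `honest k` says that block `k` is honest; otherwise it is adversarial -/
  honest : ℕ → Prop
  /-- `parent k` is the number of the parent block of block `k`, for `k ≥ 1`
  (the value `parent 0` is never used) -/
  parent : ℕ → ℕ
  /-- `pub k` is the time at which block `k` is published, `⊤` if this never happens -/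
  pub : ℕ → EReal
  time_zero : time 0 = 0
  time_pos : ∀ k, 0 < k → 0 < time k
  time_mono : Monotone time
  /-- only finitely many blocks are mined by any given time -/
  time_tendsto : Tendsto time atTop atTop
  honest_zero : honest 0
  parent_lt : ∀ k, 0 < k → parent k < k
  time_le_pub : ∀ k, (time k : EReal) ≤ pub k

namespace BlockTree

/-- Blockchain `k`: the sequence `(b₀, b₁, …, bₙ)` of block numbers with `b₀ = 0`, `bₙ = k` in which
every block is preceded by its parent. -/
def chain (B : BlockTree) : ℕ → List ℕ
  | 0 => [0]
  | k + 1 => B.chain (B.parent (k + 1)) ++ [k + 1]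
termination_by k => k
decreasing_by exact B.parent_lt _ (Nat.succ_pos _)

/-- The height of blockchain `k`: the number of its non-genesis blocks. -/
def height (B : BlockTree) (k : ℕ) : ℕ := (B.chain k).length - 1

/-- Blockchain `k` is published by time `t`: all of its blocks are. -/
def PublishedBy (B : BlockTree) (t : ℝ) (k : ℕ) : Prop := ∀ i ∈ B.chain k, B.pub i ≤ (t : EReal)

/-- Blockchain `b` is `t`-credible: it is published by time `t`, and it is no shorter than any
blockchain published by time `t - Δ`. -/
def Credible (B : BlockTree) (Δ t : ℝ) (b : ℕ) : Prop :=
  B.PublishedBy t b ∧ ∀ k, B.PublishedBy (t - Δ) k → B.height k ≤ B.height b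

/-- The protocol with delay bound `Δ`: an honest block is published as soon as it is mined, and a
non-genesis honest block `k` extends a blockchain that is credible at the time when `k` is mined. -/
structure FollowsProtocol (B : BlockTree) (Δ : ℝ) : Prop where
  pub_eq : ∀ k, B.honest k → B.pub k = (B.time k : EReal)
  credible_parent : ∀ k, 0 < k → B.honest k → B.Credible Δ (B.time k) (B.parent k)

/-- Block `k` is a lagger: the only honest block mined during `[T_k - Δ, T_k]`. -/
def Lagger (B : BlockTree) (Δ : ℝ) (k : ℕ) : Prop :=
  B.honest k ∧ ∀ j, B.honest j → B.time j ∈ Icc (B.time k - Δ) (B.time k) → j = k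

/-- Block `k` is a loner: a lagger that is also the only honest block mined during
`[T_k, T_k + Δ]`. -/
def Loner (B : BlockTree) (Δ : ℝ) (k : ℕ) : Prop :=
  B.Lagger Δ k ∧ ∀ j, B.honest j → B.time j ∈ Icc (B.time k) (B.time k + Δ) → j = k

/-- The number of honest blocks mined during `(s, t]`. -/
noncomputable def numHonest (B : BlockTree) (s t : ℝ) : ℕ :=
  {k | B.honest k ∧ B.time k ∈ Ioc s t}.ncard

/-- The number of laggers mined during `(s, t]`. -/
noncomputable def numLagger (B : BlockTree) (Δ s t : ℝ) : ℕ :=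
  {k | B.Lagger Δ k ∧ B.time k ∈ Ioc s t}.ncard

/-- The number of loners mined during `(s, t]`. -/
noncomputable def numLoner (B : BlockTree) (Δ s t : ℝ) : ℕ :=
  {k | B.Loner Δ k ∧ B.time k ∈ Ioc s t}.ncard

/-- The number of adversarial blocks mined during `(s, t]`. -/
noncomputable def numAdv (B : BlockTree) (s t : ℝ) : ℕ :=
  {k | ¬ B.honest k ∧ B.time k ∈ Ioc s t}.ncard

/-- The `j`-deep prefix `(b₀, …, bₙ₋ⱼ)` of blockchain `b = (b₀, …, bₙ)`; it is meant to be used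
for `j ≤ n`, where `n` is the height of `b`. -/
def deepPrefix (B : BlockTree) (j b : ℕ) : List ℕ :=
  (B.chain b).take ((B.chain b).length - j)

/-- The sequence `l` of blocks is permanent after `t`: every `r`-credible blockchain with `r ≥ t`
extends it. -/
def PermanentAfter (B : BlockTree) (Δ t : ℝ) (l : List ℕ) : Prop :=
  ∀ r, t ≤ r → ∀ d, B.Credible Δ r d → l <+: B.chain d

end BlockTree

/-- The random outcome of the system under a fixed, arbitrary adversarial strategy. Honest blocks
are mined as a homogeneous Poisson process of rate `α`; the number of adversarial blocks mined
during `(s, t]` is stochastically dominated by a Poisson variable of mean `β (t - s)`. No relation is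
assumed between the two mining processes, the parents and publication times of adversarial
blocks, and the choice that honest blocks make among credible blockchains. -/
structure MiningSystem {Ω : Type*} [MeasurableSpace Ω] (P : Measure Ω) (α β Δ : ℝ) where
  /-- the realized system -/
  out : Ω → BlockTree
  follows : ∀ ω, (out ω).FollowsProtocol Δ
  measurable_time : ∀ k, Measurable fun ω => (out ω).time k
  measurable_honest : ∀ k, MeasurableSet {ω | (out ω).honest k}
  indep_increments :
    HasIndepIncrements (fun (t : ℝ≥0) ω => (out ω).numHonest 0 (t : ℝ)) P
  poisson_increments : ∀ s t : ℝ, 0 ≤ s → s < t →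
    HasLaw (fun ω => (out ω).numHonest s t) (poissonMeasure (α * (t - s)).toNNReal) P
  adv_bound : ∀ s t : ℝ, 0 ≤ s → s < t → ∀ n : ℕ,
    Real.exp (-(β * (t - s))) * ∑ i ∈ Finset.range (n + 1), (β * (t - s)) ^ i / (i.factorial : ℝ)
      ≤ P.real {ω | (out ω).numAdv s t ≤ n}

/-- The propagation discount `g = exp (-α Δ)`. -/
noncomputable def discount (α Δ : ℝ) : ℝ := Real.exp (-(α * Δ))

/-- `η = δ² g² α` -/
noncomputable def etaParam (α Δ δ : ℝ) : ℝ := δ ^ 2 * discount α Δ ^ 2 * α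

/-- `μ = 9 exp (2 η / 27) / (1 - exp (-η / 27))²` -/
noncomputable def muParam (α Δ δ : ℝ) : ℝ :=
  9 * Real.exp (2 / 27 * etaParam α Δ δ) / (1 - Real.exp (-(1 / 27 * etaParam α Δ δ))) ^ 2

namespace MiningSystem

variable {Ω : Type*} [MeasurableSpace Ω] {P : Measure Ω} {α β Δ : ℝ}

/-- The `δ`-good event with respect to the time interval `(s, t]`. -/
def goodEvent (S : MiningSystem P α β Δ) (δ s t : ℝ) : Set Ω :=
  {ω | (1 - δ) * (t - s) * α < (S.out ω).numHonest s t ∧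
      (S.out ω).numHonest s t < (1 + δ) * (t - s) * α} ∩
  {ω | (1 - δ) * (t - s) * discount α Δ * α < (S.out ω).numLagger Δ s t} ∩
  {ω | (1 - δ) * (t - s) * discount α Δ ^ 2 * α < (S.out ω).numLoner Δ s t} ∩
  {ω | (S.out ω).numAdv s t < (t - s) * β + (t - s) * discount α Δ ^ 2 * α * δ}

/-- The `δ`-typical event on the time interval `(s, t]`: the intersection of the good events with
respect to all `(a, b]` with `a ∈ [0, s]` and `b ∈ [t, ∞)`. -/
def typicalEvent (S : MiningSystem P α β Δ) (δ s t : ℝ) : Set Ω :=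
  ⋂ a ∈ Icc 0 s, ⋂ b ∈ Ici t, S.goodEvent δ a b

end MiningSystem

open scoped ENNReal

/-! ### Combinatorics of the block tree. -/

namespace BlockTree

variable (B : BlockTree)

/-! The deterministic half rests on one matching argument. An honest block is at least one higher
than anything published `Δ` before it is mined. So laggers have distinct heights, and a loner is the
only honest block at its height. Suppose that block `p` of a `t`-credible chain is missing from a
chain that is credible later. Stop at the first moment `r ≥ t` at which a chain `d` without `p`
competes, and let `e` be the last honest block that `d` shares with the chain of `p`. At the height
of every loner mined after `e` and by time `r - Δ` there is a block on `d` and one on some chain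
through `p`. They cannot both be honest, since then both would be that loner, which would put `p` on
`d` or contradict the choice of `e`. So adversarial blocks outnumber these loners
(`numLoner_le_numAdv`, `exists_numLoner_le_numAdv`). On a typical outcome this is impossible over a
long interval, because `β` is below `g ^ 2 * α` with room to spare. The interval is long because the
last `k` blocks of a credible chain cannot all be mined during a time `k / (2 * α)`; and the chain
is high enough because its height is at least the number of laggers (`common_prefix`).

The probabilistic half bounds the failure of typicality by Chernoff estimates. Poisson exponential
moments handle the honest and adversarial counts. Laggers and loners are not independent of each
other, so time is cut into short slots with independent Poisson contents, which are read by a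
finite-memory automaton that never overcounts (`runAutomaton_slotStep_le`). A potential that shrinks
by a fixed factor on average at each slot (`slotPotential_drift`) yields the exponential moment of
its counters. Finally, the uncountably many intervals in the typical event are covered by unit cells
of endpoints, and a double geometric series sums the bounds
(`exists_measurableSet_subset_typicalEvent`). -/

theorem chain_of_pos {k : ℕ} (hk : 0 < k) : B.chain k = B.chain (B.parent k) ++ [k] := by
  cases k with
  | zero => omega
  | succ k => rw [chain]

theorem chain_zero : B.chain 0 = [0] := by rw [chain]

theorem mem_chain_self (k : ℕ) : k ∈ B.chain k := by
  rcases Nat.eq_zero_or_pos k with rfl | hk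
  · simp [chain_zero]
  · simp [B.chain_of_pos hk]

theorem chain_ne_nil (k : ℕ) : B.chain k ≠ [] := List.ne_nil_of_mem (B.mem_chain_self k)

theorem length_chain (k : ℕ) : (B.chain k).length = B.height k + 1 := by
  have := List.length_pos_of_ne_nil (B.chain_ne_nil k)
  unfold height; omega

theorem height_zero : B.height 0 = 0 := by simp [height, chain_zero]

theorem height_of_pos {k : ℕ} (hk : 0 < k) : B.height k = B.height (B.parent k) + 1 := by
  have h := congrArg List.length (B.chain_of_pos hk)
  simp only [List.length_append, length_chain, List.length_singleton] at h
  omega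

theorem mem_chain_of_pos {i k : ℕ} (hk : 0 < k) :
    i ∈ B.chain k ↔ i ∈ B.chain (B.parent k) ∨ i = k := by
  simp [B.chain_of_pos hk]

theorem le_of_mem_chain {i k : ℕ} (h : i ∈ B.chain k) : i ≤ k := by
  induction k using Nat.strong_induction_on with
  | _ k ih =>
    rcases Nat.eq_zero_or_pos k with rfl | hk
    · simpa [chain_zero] using h
    · rcases (B.mem_chain_of_pos hk).1 h with h | h
      · exact (ih _ (B.parent_lt k hk) h).trans (B.parent_lt k hk).le
      · exact h.le

theorem prefix_of_mem_chain {i k : ℕ} (h : i ∈ B.chain k) : B.chain i <+: B.chain k := by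
  induction k using Nat.strong_induction_on with
  | _ k ih =>
    rcases Nat.eq_zero_or_pos k with rfl | hk
    · have : i = 0 := by simpa [chain_zero] using h
      rw [this]
    · rcases (B.mem_chain_of_pos hk).1 h with h | h
      · exact (ih _ (B.parent_lt k hk) h).trans (B.chain_of_pos hk ▸ List.prefix_append _ _)
      · rw [h]

theorem mem_chain_iff_prefix {i k : ℕ} : i ∈ B.chain k ↔ B.chain i <+: B.chain k :=
  ⟨B.prefix_of_mem_chain, fun h => h.subset (B.mem_chain_self i)⟩

theorem mem_chain_trans {i j k : ℕ} (hij : i ∈ B.chain j) (hjk : j ∈ B.chain k) : i ∈ B.chain k :=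
  (B.prefix_of_mem_chain hjk).subset hij

theorem height_le_of_mem {i k : ℕ} (h : i ∈ B.chain k) : B.height i ≤ B.height k := by
  have := (B.prefix_of_mem_chain h).length_le
  simp only [length_chain] at this
  omega

theorem mem_chain_of_height_le {i j k : ℕ} (hi : i ∈ B.chain k) (hj : j ∈ B.chain k)
    (hij : B.height i ≤ B.height j) : i ∈ B.chain j := by
  rw [mem_chain_iff_prefix] at *
  refine List.prefix_of_prefix_length_le hi hj ?_
  simpa only [length_chain, add_le_add_iff_right]

theorem zero_mem_chain (k : ℕ) : 0 ∈ B.chain k := by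
  induction k using Nat.strong_induction_on with
  | _ k ih =>
    rcases Nat.eq_zero_or_pos k with rfl | hk
    · simp [chain_zero]
    · exact (B.mem_chain_of_pos hk).2 (.inl (ih _ (B.parent_lt k hk)))

theorem exists_mem_chain_height {k h : ℕ} (hh : h ≤ B.height k) :
    ∃ i ∈ B.chain k, B.height i = h := by
  induction k using Nat.strong_induction_on with
  | _ k ih =>
    rcases hh.eq_or_lt with rfl | hlt
    · exact ⟨k, B.mem_chain_self k, rfl⟩
    rcases Nat.eq_zero_or_pos k with rfl | hk
    · simp [height_zero] at hlt
    · rw [B.height_of_pos hk] at hlt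
      obtain ⟨i, hi, hi'⟩ := ih _ (B.parent_lt k hk) (by omega)
      exact ⟨i, (B.mem_chain_of_pos hk).2 (.inl hi), hi'⟩

theorem lt_of_mem_chain_height_lt {i k : ℕ} (h : i ∈ B.chain k) (hlt : B.height i < B.height k) :
    i < k := by
  refine lt_of_le_of_ne (B.le_of_mem_chain h) ?_
  rintro rfl
  exact hlt.false

theorem exists_deepPrefix_eq {j b : ℕ} (hj : j ≤ B.height b) :
    ∃ p ∈ B.chain b, B.height p = B.height b - j ∧ B.deepPrefix j b = B.chain p := by
  obtain ⟨p, hp, hph⟩ := B.exists_mem_chain_height (Nat.sub_le (B.height b) j)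
  refine ⟨p, hp, hph, ?_⟩
  have h := List.prefix_iff_eq_take.1 (B.prefix_of_mem_chain hp)
  rw [deepPrefix, h, length_chain, length_chain, hph]
  congr 1
  omega

variable {B}

theorem PublishedBy.of_mem {t : ℝ} {i k : ℕ} (h : B.PublishedBy t k) (hi : i ∈ B.chain k) :
    B.PublishedBy t i := fun _ hj => h _ (B.mem_chain_trans hj hi)

theorem PublishedBy.mono {s t : ℝ} {k : ℕ} (h : B.PublishedBy s k) (hst : s ≤ t) :
    B.PublishedBy t k := fun i hi => (h i hi).trans (EReal.coe_le_coe_iff.2 hst)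

theorem PublishedBy.time_le {t : ℝ} {k : ℕ} (h : B.PublishedBy t k) : B.time k ≤ t :=
  EReal.coe_le_coe_iff.1 ((B.time_le_pub k).trans (h k (B.mem_chain_self k)))

variable (B) in
theorem time_nonneg (k : ℕ) : 0 ≤ B.time k := B.time_zero ▸ B.time_mono (Nat.zero_le k)

variable (B) in
theorem finite_time_le (t : ℝ) : {k | B.time k ≤ t}.Finite := by
  obtain ⟨N, hN⟩ := (B.time_tendsto.eventually (eventually_gt_atTop t)).exists_forall_of_atTop
  exact (Set.finite_lt_nat N).subset fun k hk => not_le.1 fun h => (hN k h).not_ge hk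

variable (B) in
theorem finite_time_mem_Ioc (p : ℕ → Prop) (s t : ℝ) : {k | p k ∧ B.time k ∈ Ioc s t}.Finite :=
  (B.finite_time_le t).subset fun _ hk => hk.2.2

/-! ### Heights of honest blocks, and matching loners with adversarial blocks. -/

namespace FollowsProtocol

variable {Δ : ℝ}

theorem publishedBy_time (hB : B.FollowsProtocol Δ) {k : ℕ} (hk : B.honest k) :
    B.PublishedBy (B.time k) k := by
  intro i hi
  rcases Nat.eq_zero_or_pos k with rfl | hpos
  · have : i = 0 := by simpa [chain_zero] using hi
    rw [this, hB.pub_eq _ hk]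
  · rcases (B.mem_chain_of_pos hpos).1 hi with hi | rfl
    · exact (hB.credible_parent k hpos hk).1 i hi
    · rw [hB.pub_eq _ hk]

theorem height_lt_of_publishedBy (hB : B.FollowsProtocol Δ) {j k : ℕ} (hk : 0 < k)
    (hkh : B.honest k) (hj : B.PublishedBy (B.time k - Δ) j) : B.height j < B.height k := by
  have := (hB.credible_parent k hk hkh).2 j hj
  rw [B.height_of_pos hk]
  omega

/-- Every honest block preceding a lagger was mined, hence published, more than `Δ` before it, so
the parent of the lagger is at least as high. -/
theorem height_lt_of_lagger (hB : B.FollowsProtocol Δ) {j k : ℕ} (hj : B.honest j)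
    (hk : B.Lagger Δ k) (hjk : j < k) : B.height j < B.height k := by
  refine hB.height_lt_of_publishedBy (by omega) hk.1 ((hB.publishedBy_time hj).mono ?_)
  by_contra! h
  exact hjk.ne (hk.2 j hj ⟨h.le, B.time_mono hjk.le⟩)

theorem height_lt_of_loner (hB : B.FollowsProtocol Δ) {j k : ℕ} (hj : B.honest j)
    (hk : B.Loner Δ k) (hjk : k < j) : B.height k < B.height j := by
  refine hB.height_lt_of_publishedBy (by omega) hj ((hB.publishedBy_time hk.1.1).mono ?_)
  by_contra! h
  exact hjk.ne' (hk.2 j hj ⟨B.time_mono hjk.le, by linarith⟩)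

/-- A loner is strictly higher than all honest blocks before it and strictly lower than all honest
blocks after it. -/
theorem eq_loner_of_height_eq (hB : B.FollowsProtocol Δ) {j k : ℕ} (hj : B.honest j)
    (hk : B.Loner Δ k) (h : B.height j = B.height k) : j = k := by
  rcases lt_trichotomy j k with hlt | heq | hlt
  · exact absurd h (hB.height_lt_of_lagger hj hk.1 hlt).ne
  · exact heq
  · exact absurd h (hB.height_lt_of_loner hj hk hlt).ne'

theorem height_injOn_lagger (hB : B.FollowsProtocol Δ) :
    Set.InjOn B.height {k | B.Lagger Δ k} := by
  intro j hj k hk h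
  by_contra hne
  rcases Nat.lt_or_gt_of_ne hne with hlt | hlt
  · exact (hB.height_lt_of_lagger hj.1 hk hlt).ne h
  · exact (hB.height_lt_of_lagger hk.1 hj hlt).ne' h

/-- Laggers mined by `t - Δ` have distinct positive heights, none exceeding that of a `t`-credible
chain. -/
theorem numLagger_le_height (hB : B.FollowsProtocol Δ) {t : ℝ} {b : ℕ}
    (hb : B.Credible Δ t b) : B.numLagger Δ 0 (t - Δ) ≤ B.height b := by
  have hmaps : Set.MapsTo B.height {k | B.Lagger Δ k ∧ B.time k ∈ Ioc 0 (t - Δ)}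
      (Set.Icc 1 (B.height b)) := by
    rintro k ⟨hk, h0, h1⟩
    have hpos : 0 < k := Nat.pos_of_ne_zero fun h => by simp [h, B.time_zero] at h0
    refine ⟨?_, hb.2 k ((hB.publishedBy_time hk.1).mono h1)⟩
    rw [B.height_of_pos hpos]
    omega
  have := Set.ncard_le_ncard_of_injOn B.height hmaps
    (hB.height_injOn_lagger.mono fun k hk => hk.1) (Set.finite_Icc _ _)
  simpa [numLagger, Set.ncard_eq_toFinset_card'] using this

/-- Every loner mined after the last honest block `e` that the chains `p` and `d` share is matched by
an adversarial block of the same height. -/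
theorem numLoner_le_numAdv (hB : B.FollowsProtocol Δ) {p d e : ℕ} {a r u : ℝ}
    (hdp : p ∉ B.chain d) (hd : B.PublishedBy r d)
    (hep : e ∈ B.chain p) (hed : e ∈ B.chain d) (heh : B.honest e)
    (hmax : ∀ i, B.honest i → i ∈ B.chain p → i ∈ B.chain d → B.height i ≤ B.height e)
    (ha : ∀ i, e < i → a < B.time i)
    (hl : ∀ l, B.Loner Δ l → B.time l ∈ Ioc (B.time e) u → B.height l ≤ B.height d ∧
      ∃ c, B.PublishedBy r c ∧ p ∈ B.chain c ∧ B.height l ≤ B.height c) :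
    B.numLoner Δ (B.time e) u ≤ B.numAdv a r := by
  have key : ∀ l, B.Loner Δ l ∧ B.time l ∈ Ioc (B.time e) u →
      ∃ x, (¬ B.honest x ∧ B.time x ∈ Ioc a r) ∧ B.height x = B.height l := by
    rintro l ⟨hlon, hlt⟩
    obtain ⟨hld, c, hcr, hpc, hlc⟩ := hl l hlon hlt
    have hel : e < l := by
      by_contra! h
      exact (B.time_mono h).not_gt hlt.1
    have hhel := hB.height_lt_of_lagger heh hlon.1 hel
    have aux : ∀ f x, B.PublishedBy r f → e ∈ B.chain f → x ∈ B.chain f →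
        B.height x = B.height l → B.time x ∈ Ioc a r := by
      intro f x hf hef hxf hx
      have hex := B.lt_of_mem_chain_height_lt (B.mem_chain_of_height_le hef hxf (by omega))
        (by omega)
      exact ⟨ha x hex, (hf.of_mem hxf).time_le⟩
    -- Compare the blocks `x` on `c` and `y` on `d` at the height of the loner `l`; one of them will
    -- be adversarial.
    obtain ⟨x, hxc, hx⟩ := B.exists_mem_chain_height hlc
    obtain ⟨y, hyd, hy⟩ := B.exists_mem_chain_height hld
    by_cases hxh : B.honest x
    swap
    · exact ⟨x, ⟨hxh, aux c x hcr (B.mem_chain_trans hep hpc) hxc hx⟩, hx⟩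
    by_cases hyh : B.honest y
    swap
    · exact ⟨y, ⟨hyh, aux d y hd hed hyd hy⟩, hy⟩
    exfalso
    obtain rfl := hB.eq_loner_of_height_eq hxh hlon hx
    obtain rfl := hB.eq_loner_of_height_eq hyh hlon hy
    -- The loner now lies on both `c` and `d`. If it is not below `p`, then `p` is on `d`; otherwise
    -- it is a common honest block of `p` and `d` higher than `e`.
    rcases le_total (B.height p) (B.height y) with h | h
    · exact hdp (B.mem_chain_trans (B.mem_chain_of_height_le hpc hxc h) hyd)
    · exact (hmax y hyh (B.mem_chain_of_height_le hxc hpc h) hyd).not_gt hhel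
  choose! f hf hfh using key
  refine Set.ncard_le_ncard_of_injOn f hf ?_ (B.finite_time_mem_Ioc _ _ _)
  intro i hi j hj hij
  refine hB.height_injOn_lagger hi.1.1 hj.1.1 ?_
  rw [← hfh i hi, ← hfh j hj, hij]

end FollowsProtocol

/-- The blocks from `p` on of a chain published by time `t` are mined after time `s` if `p` is, so
that there are at most as many of them as blocks mined during `(s, t]`. -/
theorem height_sub_lt_numHonest_add_numAdv {p b : ℕ} {s t : ℝ} (hb : B.PublishedBy t b)
    (hp : p ∈ B.chain b) (hs : s < B.time p) :
    B.height b - B.height p < B.numHonest s t + B.numAdv s t := by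
  have key : ∀ h ∈ Set.Icc (B.height p) (B.height b),
      ∃ x, B.time x ∈ Ioc s t ∧ B.height x = h := by
    rintro h ⟨h1, h2⟩
    obtain ⟨x, hx, rfl⟩ := B.exists_mem_chain_height h2
    exact ⟨x, ⟨hs.trans_le (B.time_mono (B.le_of_mem_chain (B.mem_chain_of_height_le hp hx h1))),
      (hb.of_mem hx).time_le⟩, rfl⟩
  choose! f hf hfh using key
  have hle := Set.ncard_le_ncard_of_injOn (t := {x | B.time x ∈ Ioc s t}) f hf
    (fun i hi j hj hij => by rw [← hfh i hi, ← hfh j hj, hij])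
    ((B.finite_time_le t).subset fun _ hk => hk.2)
  have hunion : {x | B.time x ∈ Ioc s t} = {k | B.honest k ∧ B.time k ∈ Ioc s t} ∪
      {k | ¬ B.honest k ∧ B.time k ∈ Ioc s t} := by
    ext x; simp only [mem_ofPred_eq, mem_union]; tauto
  have hle2 := Set.ncard_union_le {k | B.honest k ∧ B.time k ∈ Ioc s t}
      {k | ¬ B.honest k ∧ B.time k ∈ Ioc s t}
  rw [← hunion] at hle2
  have hcard : (Set.Icc (B.height p) (B.height b)).ncard = B.height b + 1 - B.height p := by
    simp [Set.ncard_eq_toFinset_card']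
  have hph := B.height_le_of_mem hp
  rw [hcard] at hle
  unfold numHonest numAdv
  omega

end BlockTree

/-! ### The common prefix property on typical outcomes. -/

namespace BlockTree

variable {B : BlockTree} {Δ : ℝ}

namespace FollowsProtocol

theorem exists_highest_published (hB : B.FollowsProtocol Δ) {t : ℝ} (ht : 0 ≤ t) :
    ∃ m, B.PublishedBy t m ∧ ∀ k, B.PublishedBy t k → B.height k ≤ B.height m := by
  have h0 : B.PublishedBy t 0 :=
    (hB.publishedBy_time B.honest_zero).mono (by rwa [B.time_zero])
  obtain ⟨m, hm, hmax⟩ := Set.exists_max_image {k | B.PublishedBy t k} B.height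
    ((B.finite_time_le t).subset fun k hk => PublishedBy.time_le hk) ⟨0, h0⟩
  exact ⟨m, hm, hmax⟩

end FollowsProtocol

variable (B) in
theorem exists_last_common_honest (p d : ℕ) :
    ∃ e, B.honest e ∧ e ∈ B.chain p ∧ e ∈ B.chain d ∧
      ∀ i, B.honest i → i ∈ B.chain p → i ∈ B.chain d → B.height i ≤ B.height e := by
  obtain ⟨e, he, hmax⟩ := Set.exists_max_image
    {i | B.honest i ∧ i ∈ B.chain p ∧ i ∈ B.chain d} B.height
    ((Set.finite_le_nat p).subset fun k hk => B.le_of_mem_chain hk.2.1)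
    ⟨0, B.honest_zero, B.zero_mem_chain p, B.zero_mem_chain d⟩
  exact ⟨e, he.1, he.2.1, he.2.2, fun i h1 h2 h3 => hmax i ⟨h1, h2, h3⟩⟩

namespace FollowsProtocol

/-- If block `p` of a credible chain is abandoned later on, then from some honest ancestor of `p`
on the loners are outnumbered by adversarial blocks. -/
theorem exists_numLoner_le_numAdv (hB : B.FollowsProtocol Δ) (hΔ : 0 < Δ) {t : ℝ} (ht : 0 ≤ t)
    {b p : ℕ} (hb : B.Credible Δ t b) (hp : p ∈ B.chain b)
    {r₀ : ℝ} {d₀ : ℕ} (hr₀ : t ≤ r₀) (hd₀ : B.Credible Δ r₀ d₀)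
    (hpd₀ : p ∉ B.chain d₀) :
    ∃ r, t ≤ r ∧ ∃ e ∈ B.chain p, ∀ a, (∀ i, e < i → a < B.time i) →
      B.numLoner Δ (B.time e) (r - Δ) ≤ B.numAdv a r := by
  obtain ⟨m, hm, hmmax⟩ := hB.exists_highest_published ht
  -- If the highest chain `m` published at time `t` avoids `p`, the competition is already on at `r
  -- = t`, between `m` and `b`.
  by_cases hpm : p ∈ B.chain m
  swap
  · obtain ⟨e, heh, hep, hem, hmax⟩ := B.exists_last_common_honest p m
    refine ⟨t, le_rfl, e, hep, fun a ha => hB.numLoner_le_numAdv hpm hm hep hem heh hmax ha ?_⟩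
    intro l hl hlt
    have hpub := (hB.publishedBy_time hl.1.1).mono hlt.2
    exact ⟨hmmax l (hpub.mono (by linarith)), b, hb.1, hp, hb.2 l hpub⟩
  -- The moment of defection: take the parent of the first honest block after `t` whose chain avoids
  -- `p`, or `d₀` at time `r₀` if there is no such block. Until then all honest blocks mined after
  -- `t` build on `p`.
  obtain ⟨r, d, hr, hd, hpd, hext⟩ : ∃ r d, t ≤ r ∧ B.Credible Δ r d ∧ p ∉ B.chain d ∧
      ∀ l, B.honest l → t < B.time l → B.time l < r → p ∈ B.chain l := by
    by_cases hex : ∃ j, B.honest j ∧ t < B.time j ∧ p ∉ B.chain j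
    · classical
      have hspec := Nat.find_spec hex
      set j := Nat.find hex with hj
      have hjpos : 0 < j := Nat.pos_of_ne_zero fun h => by
        have := hspec.2.1
        rw [h, B.time_zero] at this
        linarith
      refine ⟨B.time j, B.parent j, hspec.2.1.le, hB.credible_parent j hjpos hspec.1,
        fun h => hspec.2.2 ((B.mem_chain_of_pos hjpos).2 (.inl h)), fun l hl htl hlj => ?_⟩
      by_contra hpl
      have hjl : j ≤ l := Nat.find_min' hex ⟨hl, htl, hpl⟩
      exact (B.time_mono hjl).not_gt hlj
    · push Not at hex
      exact ⟨r₀, d₀, hr₀, hd₀, hpd₀, fun l hl htl _ => hex l hl htl⟩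
  obtain ⟨e, heh, hep, hed, hmax⟩ := B.exists_last_common_honest p d
  refine ⟨r, hr, e, hep, fun a ha => hB.numLoner_le_numAdv hpd hd.1 hep hed heh hmax ha ?_⟩
  intro l hl hlt
  have hpub := hB.publishedBy_time hl.1.1
  refine ⟨hd.2 l (hpub.mono hlt.2), ?_⟩
  -- The chain through `p` that is as high as `l` is `m` for a loner mined by time `t`, and that of
  -- `l` itself afterwards.
  rcases le_or_gt (B.time l) t with h | h
  · exact ⟨m, hm.mono hr, hpm, hmmax l (hpub.mono h)⟩
  · exact ⟨l, hpub.mono (by linarith [hlt.2]), hext l hl.1.1 h (by linarith [hlt.2]), le_rfl⟩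

/-- The deterministic common prefix property. `g` is the discount factor. -/
theorem common_prefix (hB : B.FollowsProtocol Δ) {α β δ g t : ℝ} {k : ℕ}
    (hα : 0 < α) (hβ : 0 ≤ β) (hΔ : 0 < Δ) (hδ : 0 < δ) (hδ' : δ < 40 / 81)
    (hg : 0 < g) (hg1 : g ≤ 1) (hαβ : β < (1 - 81 / 40 * δ) * g ^ 2 * α)
    (hk : 160 * α * (1 + Δ) / δ ≤ k) (ht : k / ((1 - 41 / 40 * δ) * g * α) ≤ t)
    (hgood : ∀ a ∈ Icc 0 (t - k / (2 * α) + Δ), ∀ b ∈ Ici (t - Δ),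
      B.numHonest a b < (1 + δ) * (b - a) * α ∧
      (1 - δ) * (b - a) * g * α < B.numLagger Δ a b ∧
      (1 - δ) * (b - a) * g ^ 2 * α < B.numLoner Δ a b ∧
      B.numAdv a b < (b - a) * β + (b - a) * g ^ 2 * α * δ)
    {b : ℕ} (hb : B.Credible Δ t b) :
    k - 1 ≤ B.height b ∧ ∀ r, t ≤ r → ∀ d, B.Credible Δ r d →
      B.deepPrefix (k - 1) b <+: B.chain d := by
  have hk1 : 160 * α * (1 + Δ) ≤ k * δ := by rwa [div_le_iff₀ hδ] at hk
  have hkpos : (0 : ℝ) < k := by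
    have : 0 < k * δ := lt_of_lt_of_le (by positivity) hk1
    exact pos_of_mul_pos_left this hδ.le
  have hc : 0 < 1 - 41 / 40 * δ := by linarith
  have ht1 : k ≤ t * ((1 - 41 / 40 * δ) * g * α) := by
    rwa [div_le_iff₀ (by positivity)] at ht
  set w := (k : ℝ) / (2 * α) with hw
  have hkw : (k : ℝ) = 2 * α * w := by rw [hw]; field_simp
  have hwpos : 0 < w := by positivity
  have hwδ : 80 * (1 + Δ) ≤ w * δ := by
    have : 2 * α * (80 * (1 + Δ)) ≤ 2 * α * (w * δ) := by
      calc _ = 160 * α * (1 + Δ) := by ring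
        _ ≤ k * δ := hk1
        _ = _ := by rw [hkw]; ring
    exact le_of_mul_le_mul_left this (by positivity)
  have htpos : 0 < t := lt_of_lt_of_le (by positivity) ht
  have htw : w ≤ t := by
    have h1 : (1 - 41 / 40 * δ) * g * α ≤ α :=
      mul_le_of_le_one_left hα.le (mul_le_one₀ (by linarith) hg.le hg1)
    have h2 := mul_le_mul_of_nonneg_left h1 htpos.le
    have h3 : α * w ≤ α * t := by linarith [mul_pos hα hwpos]
    exact le_of_mul_le_mul_left h3 hα
  have hgood0 := hgood 0 ⟨le_rfl, by linarith⟩ (t - Δ) (by simp)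
  have hg2 : g ^ 2 ≤ 1 := pow_le_one₀ hg.le hg1
  have hheight : k ≤ B.height b := by
    have h1 : (B.numLagger Δ 0 (t - Δ) : ℝ) ≤ B.height b := by
      exact_mod_cast hB.numLagger_le_height hb
    have h2 := hgood0.2.1
    have h3 := mul_le_mul_of_nonneg_left ht1 (by linarith : 0 ≤ 1 - δ)
    have h4 : (1 - δ) * (Δ * g * α) ≤ α * Δ := by
      have : (1 - δ) * g ≤ 1 := mul_le_one₀ (by linarith) hg.le hg1
      linarith [mul_le_mul_of_nonneg_right this (mul_pos hα hΔ).le]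
    have h5 : (1 - 41 / 40 * δ) * k ≤ (1 - 41 / 40 * δ) * ((1 - δ) * t * g * α - α * Δ) := by
      linarith [mul_pos hα hΔ, mul_pos (mul_pos hα hΔ) hδ]
    have h6 := le_of_mul_le_mul_left h5 hc
    have h7 : (k : ℝ) ≤ B.height b := by linarith
    exact_mod_cast h7
  refine ⟨by omega, ?_⟩
  obtain ⟨p, hp, hph, hpre⟩ := B.exists_deepPrefix_eq (j := k - 1) (b := b) (by omega)
  have hkpos' : 0 < k := by exact_mod_cast hkpos
  -- There are `k` blocks from `p` to the tip of `b`. During `(t - w, t]` fewer than `w * α * (2 - δ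
  -- / 40) < 2 * α * w = k` blocks are mined.
  have hpt : B.time p ≤ t - w := by
    by_contra! hlt
    have h1 := height_sub_lt_numHonest_add_numAdv hb.1 hp hlt
    have h2 : (k : ℝ) ≤ B.numHonest (t - w) t + B.numAdv (t - w) t := by
      exact_mod_cast (by omega : k ≤ B.numHonest (t - w) t + B.numAdv (t - w) t)
    obtain ⟨h3, -, -, h4⟩ := hgood (t - w) ⟨by linarith, by linarith⟩ t (by simp; linarith)
    have e : t - (t - w) = w := by ring
    rw [e] at h3 h4
    have h5 : β + g ^ 2 * α * δ ≤ (1 - 41 / 40 * δ) * α := by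
      have : (1 - 41 / 40 * δ) * (g ^ 2 * α) ≤ (1 - 41 / 40 * δ) * α :=
        mul_le_mul_of_nonneg_left (mul_le_of_le_one_left hα.le hg2) hc.le
      linarith
    have h6 := mul_le_mul_of_nonneg_left h5 hwpos.le
    linarith [mul_pos (mul_pos hwpos hα) hδ]
  intro r₀ hr₀ d₀ hd₀
  rw [hpre, ← mem_chain_iff_prefix]
  by_contra hpd
  obtain ⟨r, hr, e, hep, hle⟩ := hB.exists_numLoner_le_numAdv hΔ htpos.le hb hp
    hr₀ hd₀ hpd
  have het : B.time e ≤ t - w := (B.time_mono (B.le_of_mem_chain hep)).trans hpt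
  have he0 := B.time_nonneg e
  obtain ⟨-, -, hY, -⟩ := hgood (B.time e) ⟨he0, by linarith⟩ (r - Δ) (by simp; linarith)
  -- Several blocks may be mined at the same time, so adversarial descendants of `e` need not be
  -- mined strictly after `B.time e`. Starting one time unit earlier catches them all; the `1` in `1
  -- + Δ` pays for it.
  obtain ⟨-, -, -, hZ⟩ := hgood (max 0 (B.time e - 1))
    ⟨le_max_left _ _, max_le (by linarith) (by linarith)⟩ r (by simp; linarith)
  have hYZ : (B.numLoner Δ (B.time e) (r - Δ) : ℝ) ≤ B.numAdv (max 0 (B.time e - 1)) r := by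
    have := hle (max 0 (B.time e - 1)) fun i hi =>
      max_lt (B.time_pos i (by omega)) (by linarith [B.time_mono hi.le])
    exact_mod_cast this
  set D := r - B.time e with hD
  have hDw : w ≤ D := by linarith
  have hZ' : (r - max 0 (B.time e - 1)) * β + (r - max 0 (B.time e - 1)) * g ^ 2 * α * δ ≤
      (D + 1) * ((1 - 41 / 40 * δ) * (g ^ 2 * α)) := by
    have h1 : r - max 0 (B.time e - 1) ≤ D + 1 := by linarith [le_max_right 0 (B.time e - 1)]
    have h2 : β + g ^ 2 * α * δ ≤ (1 - 41 / 40 * δ) * (g ^ 2 * α) := by linarith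
    calc _ = (r - max 0 (B.time e - 1)) * (β + g ^ 2 * α * δ) := by ring
      _ ≤ (D + 1) * (β + g ^ 2 * α * δ) := by gcongr
      _ ≤ _ := by gcongr; linarith
  -- Rearranged, this says `D * δ / 40 < 1 - 41 / 40 * δ + (1 - δ) * Δ`, whereas `D * δ ≥ 80 * (1 +
  -- Δ)`.
  have hfin : (1 - δ) * (D - Δ) * (g ^ 2 * α) < (D + 1) * ((1 - 41 / 40 * δ)) * (g ^ 2 * α) := by
    have e1 : r - Δ - B.time e = D - Δ := by rw [hD]; ring
    rw [e1] at hY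
    linarith
  have hfin' := lt_of_mul_lt_mul_right hfin (by positivity)
  have : w * δ ≤ D * δ := by gcongr
  have hδΔ := mul_pos hδ hΔ
  linarith

end FollowsProtocol

end BlockTree

/-! ### Undercounting laggers and loners by a slot automaton. -/

/-- The trajectory of an automaton that reads the letters `c 0, c 1, …`. -/
def runAutomaton {S : Type*} (step : S → ℕ → S) (s₀ : S) (c : ℕ → ℕ) : ℕ → S
  | 0 => s₀
  | n + 1 => step (runAutomaton step s₀ c n) (c n)

/-- A state `(r, f, x, y)` of the automaton that scans time slots, `m` of which make up the delay
bound: `m - r` is the number of slots (at most `m`) since the last nonempty one, `f` says that this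
slot held a lagger which may still become a loner, `x` laggers and `y` loners were seen so far. -/
abbrev SlotState := ℕ × Bool × ℕ × ℕ

/-- The transition of the slot automaton at a slot with a given number of honest blocks. -/
def slotStep (m : ℕ) : SlotState → ℕ → SlotState
  | (0, _, x, y), 0 => (0, false, x, y)
  | (0, _, x, y), 1 => (m, true, x + 1, y)
  | (0, _, x, y), _ + 2 => (m, false, x, y)
  | (1, true, x, y), 0 => (0, false, x, y + 1)
  | (r + 1, f, x, y), 0 => (r, f, x, y)
  | (_ + 1, _, x, y), _ + 1 => (m, false, x, y)

theorem slotStep_succ_false_zero (m r x y : ℕ) :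
    slotStep m (r + 1, false, x, y) 0 = (r, false, x, y) := by
  cases r <;> rfl

theorem slotStep_succ_succ (m r : ℕ) (f : Bool) (x y c : ℕ) :
    slotStep m (r + 1, f, x, y) (c + 1) = (m, false, x, y) := by
  cases r <;> cases f <;> rfl

namespace BlockTree

variable (B : BlockTree)

theorem ncard_time_mem_mono (Q : ℕ → Prop) {s s' t t' : ℝ} (hs : s' ≤ s) (ht : t ≤ t') :
    {k | Q k ∧ B.time k ∈ Ioc s t}.ncard ≤ {k | Q k ∧ B.time k ∈ Ioc s' t'}.ncard :=
  Set.ncard_le_ncard (fun _ hk => ⟨hk.1, Ioc_subset_Ioc hs ht hk.2⟩) (B.finite_time_mem_Ioc _ _ _)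

theorem ncard_time_mem_succ_le (Q : ℕ → Prop) {s t t' : ℝ} {κ : ℕ} (hst : s ≤ t) (hκ : Q κ)
    (hκt : B.time κ ∈ Ioc t t') :
    {k | Q k ∧ B.time k ∈ Ioc s t}.ncard + 1 ≤ {k | Q k ∧ B.time k ∈ Ioc s t'}.ncard := by
  rw [← Set.ncard_insert_of_notMem (a := κ) (fun h => h.2.2.not_gt hκt.1)
    (B.finite_time_mem_Ioc _ _ _)]
  refine Set.ncard_le_ncard ?_ (B.finite_time_mem_Ioc _ _ _)
  rintro k (rfl | hk)
  · exact ⟨hκ, hst.trans_lt hκt.1, hκt.2⟩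
  · exact ⟨hk.1, hk.2.1, hk.2.2.trans (hκt.1.le.trans hκt.2)⟩

variable {B}

theorem not_honest_of_numHonest_eq_zero {s t : ℝ} (h : B.numHonest s t = 0) {j : ℕ}
    (hj : B.honest j) (hjt : B.time j ∈ Ioc s t) : False := by
  have := (Set.ncard_eq_zero (B.finite_time_mem_Ioc _ _ _)).1 h
  exact (this ▸ (⟨hj, hjt⟩ : j ∈ {k | B.honest k ∧ B.time k ∈ Ioc s t}) : j ∈ (∅ : Set ℕ))

theorem exists_unique_of_numHonest_eq_one {s t : ℝ} (h : B.numHonest s t = 1) :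
    ∃ κ, B.honest κ ∧ B.time κ ∈ Ioc s t ∧ ∀ j, B.honest j → B.time j ∈ Ioc s t → j = κ := by
  obtain ⟨κ, hκ⟩ := Set.ncard_eq_one.1 h
  have hmem : κ ∈ {k | B.honest k ∧ B.time k ∈ Ioc s t} := by rw [hκ]; rfl
  exact ⟨κ, hmem.1, hmem.2, fun j h1 h2 =>
    (hκ ▸ (⟨h1, h2⟩ : j ∈ {k | B.honest k ∧ B.time k ∈ Ioc s t}) : j ∈ ({κ} : Set ℕ))⟩

/-- The state of the slot automaton is compatible with the blocks mined during `(a, T]`, where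
`h` is the length of a slot. -/
structure SlotInvariant (B : BlockTree) (Δ a h : ℝ) (m : ℕ) (T E : ℝ) (s : SlotState) : Prop where
  le_start : a ≤ E
  end_eq : T = E + (m - s.1) * h
  le_max : s.1 ≤ m
  empty : ∀ j, B.honest j → B.time j ∈ Ioc E T → False
  lagger_le : s.2.2.1 ≤ B.numLagger Δ a T
  loner_le : s.2.2.2 ≤ B.numLoner Δ a T
  flag : s.2.1 = true → 0 < s.1 ∧ ∃ κ, B.Lagger Δ κ ∧ B.time κ ∈ Ioc (E - h) E ∧ a ≤ E - h ∧
    (∀ j, B.honest j → B.time j ∈ Ioc (E - h) E → j = κ) ∧ s.2.2.2 ≤ B.numLoner Δ a (E - h)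

theorem SlotInvariant.step {Δ a h T E : ℝ} {m : ℕ} {s : SlotState} (hm : 0 < m) (hh : 0 < h)
    (hmh : m * h = Δ) (H : B.SlotInvariant Δ a h m T E s) :
    ∃ E', B.SlotInvariant Δ a h m (T + h) E' (slotStep m s (B.numHonest T (T + h))) := by
  obtain ⟨r, f, x, y⟩ := s
  obtain ⟨h1, h2, h3, h4, h5, h6, h7⟩ := H
  dsimp only at h1 h2 h3 h4 h5 h6 h7
  have hTh : T ≤ T + h := by linarith
  have hr : (r : ℝ) ≤ m := by exact_mod_cast h3
  have hET : E ≤ T := by rw [h2]; nlinarith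
  have h5' : x ≤ B.numLagger Δ a (T + h) := h5.trans (B.ncard_time_mem_mono _ le_rfl hTh)
  have h6' : y ≤ B.numLoner Δ a (T + h) := h6.trans (B.ncard_time_mem_mono _ le_rfl hTh)
  have hnew : B.SlotInvariant Δ a h m (T + h) (T + h) (m, false, x, y) :=
    ⟨by linarith, by simp, le_rfl, fun j _ hj => (hj.1.trans_le hj.2).false, h5', h6', by simp⟩
  have hempty : B.numHonest T (T + h) = 0 →
      ∀ j, B.honest j → B.time j ∈ Ioc E (T + h) → False := by
    intro h0 j hj hjt
    rcases le_or_gt (B.time j) T with hle | hgt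
    · exact h4 j hj ⟨hjt.1, hle⟩
    · exact not_honest_of_numHonest_eq_zero h0 hj ⟨hgt, hjt.2⟩
  match r, f, hc : B.numHonest T (T + h) with
  -- The memory is capped at `m` empty slots, so `E` slides along with `T`.
  | 0, f, 0 =>
    refine ⟨E + h, by linarith, ?_, Nat.zero_le _, fun j hj hjt => hempty hc j hj
      ⟨by linarith [hjt.1], hjt.2⟩, h5', h6', by simp [slotStep]⟩
    simp only [slotStep] at h2 ⊢
    rw [h2]; ring
  -- The `m` empty slots before this one cover a full `Δ`, so its only honest block is a lagger.
  | 0, f, 1 =>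
    obtain ⟨κ, hκ, hκt, huniq⟩ := exists_unique_of_numHonest_eq_one hc
    have hlag : B.Lagger Δ κ := by
      refine ⟨hκ, fun j hj hjt => ?_⟩
      have hEj : E < B.time j := by
        have : T = E + Δ := by rw [h2, ← hmh]; simp
        linarith [hjt.1, hκt.1]
      rcases le_or_gt (B.time j) T with hle | hgt
      · exact (h4 j hj ⟨hEj, hle⟩).elim
      · exact huniq j hj ⟨hgt, hjt.2.trans hκt.2⟩
    have e : T + h - h = T := by ring
    refine ⟨T + h, by linarith, by simp [slotStep], le_rfl,
      fun j _ hj => (hj.1.trans_le hj.2).false, ?_, h6', fun _ => ⟨hm, κ, hlag, ?_, ?_, ?_, ?_⟩⟩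
    · exact (Nat.add_le_add_right h5 1).trans
        (B.ncard_time_mem_succ_le _ (h1.trans hET) hlag hκt)
    all_goals rw [e]
    · exact hκt
    · linarith
    · exact huniq
    · exact h6
  | 0, f, c + 2 => exact ⟨_, hnew⟩
  -- The `m`-th empty slot after the pending lagger `κ` makes it a loner. It is a new one, because
  -- the loners counted so far were mined by `E - h`, before the slot of `κ`.
  | 1, true, 0 =>
    obtain ⟨-, κ, hlag, hκt, haE, huniq, hy⟩ := h7 rfl
    have hTE : T + h = E + Δ := by rw [h2, ← hmh]; push_cast; ring
    have hlon : B.Loner Δ κ := by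
      refine ⟨hlag, fun j hj hjt => ?_⟩
      rcases le_or_gt (B.time j) E with hle | hgt
      · exact huniq j hj ⟨hκt.1.trans_le hjt.1, hle⟩
      · exact (hempty hc j hj ⟨hgt, by linarith [hjt.2, hκt.2]⟩).elim
    refine ⟨E, h1, ?_, Nat.zero_le _, hempty hc, h5', ?_, by simp [slotStep]⟩
    · simp only [slotStep]
      rw [hTE, ← hmh]; simp
    · exact ((Nat.add_le_add_right hy 1).trans
        (B.ncard_time_mem_succ_le _ haE hlon hκt)).trans
        (B.ncard_time_mem_mono _ le_rfl (by linarith))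
  | r + 1, false, 0 =>
    rw [slotStep_succ_false_zero]
    refine ⟨E, h1, ?_, by dsimp only; omega, hempty hc, h5', h6', by simp⟩
    rw [h2]; push_cast; ring
  | r + 2, true, 0 =>
    refine ⟨E, h1, ?_, by simp only [slotStep]; omega, hempty hc, h5', h6',
      fun _ => ⟨Nat.succ_pos _, (h7 rfl).2⟩⟩
    simp only [slotStep]
    rw [h2]; push_cast; ring
  | r + 1, f, c + 1 => exact ⟨_, by rw [slotStep_succ_succ]; exact hnew⟩

/-- The slot automaton counts no more laggers and loners than there are. -/
theorem runAutomaton_slotStep_le {Δ a h : ℝ} {m : ℕ} (hm : 0 < m) (hh : 0 < h) (hmh : m * h = Δ)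
    (n : ℕ) :
    (runAutomaton (slotStep m) (m, false, 0, 0)
      (fun i => B.numHonest (a + i * h) (a + (i + 1) * h)) n).2.2.1 ≤
        B.numLagger Δ a (a + n * h) ∧
    (runAutomaton (slotStep m) (m, false, 0, 0)
      (fun i => B.numHonest (a + i * h) (a + (i + 1) * h)) n).2.2.2 ≤
        B.numLoner Δ a (a + n * h) := by
  suffices ∃ E, B.SlotInvariant Δ a h m (a + n * h) E (runAutomaton (slotStep m) (m, false, 0, 0)
      (fun i => B.numHonest (a + i * h) (a + (i + 1) * h)) n) by
    obtain ⟨E, hE⟩ := this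
    exact ⟨hE.lagger_le, hE.loner_le⟩
  induction n with
  | zero =>
    refine ⟨a, le_rfl, by simp [runAutomaton], le_rfl, fun j _ hj => ?_, Nat.zero_le _,
      Nat.zero_le _, by simp [runAutomaton]⟩
    simp at hj
  | succ n ih =>
    obtain ⟨E, hE⟩ := ih
    have e : a + ((n : ℝ) + 1) * h = a + n * h + h := by ring
    obtain ⟨E', hE'⟩ := hE.step hm hh hmh
    refine ⟨E', ?_⟩
    rw [runAutomaton]
    push_cast
    rw [e]
    exact hE'

end BlockTree

/-! ### Automata reading independent letters. -/

/-- Finite dependence gives both the measurability of the state after `n` letters and its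
independence from letter `n`. -/
theorem exists_runAutomaton_eq {S : Type*} (step : S → ℕ → S) (s₀ : S) (n : ℕ) :
    ∃ F : (Finset.range n → ℕ) → S, ∀ c, runAutomaton step s₀ c n = F fun i => c i := by
  induction n with
  | zero => exact ⟨fun _ => s₀, fun _ => rfl⟩
  | succ n ih =>
    obtain ⟨F, hF⟩ := ih
    refine ⟨fun v => step (F fun i => v ⟨i, Finset.mem_range.2
      ((Finset.mem_range.1 i.2).trans n.lt_succ_self)⟩) (v ⟨n, Finset.self_mem_range_succ n⟩),
      fun c => ?_⟩
    rw [runAutomaton, hF]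

theorem aemeasurable_runAutomaton {Ω S : Type*} [MeasurableSpace Ω] [MeasurableSpace S]
    {P : Measure Ω} {c : ℕ → Ω → ℕ} (hc : ∀ i, AEMeasurable (c i) P)
    (step : S → ℕ → S) (s₀ : S) (n : ℕ) :
    AEMeasurable (fun ω => runAutomaton step s₀ (fun i => c i ω) n) P := by
  obtain ⟨F, hF⟩ := exists_runAutomaton_eq step s₀ n
  simp only [hF]
  exact (Measurable.of_discrete (f := F)).comp_aemeasurable
    (aemeasurable_pi_lambda _ fun i => hc i)

section Automaton

variable {Ω S : Type*} [MeasurableSpace Ω] [Countable S] [MeasurableSpace S]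
  [DiscreteMeasurableSpace S]

/-- If the potential `V` shrinks by the factor `σ` on average in each step, then it does so
geometrically along the run of the automaton on independent letters of law `μ`. -/
theorem lintegral_runAutomaton_le {P : Measure Ω} [IsProbabilityMeasure P] {c : ℕ → Ω → ℕ}
    (hc : ∀ i, AEMeasurable (c i) P) (hind : iIndepFun c P) {μ : Measure ℕ}
    (hlaw : ∀ i, P.map (c i) = μ) {step : S → ℕ → S} {s₀ : S} {I : S → Prop} (hI₀ : I s₀)
    (hI : ∀ s j, I s → I (step s j)) {V : S → ℝ≥0∞} {σ : ℝ≥0∞}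
    (hV : ∀ s, I s → ∫⁻ j, V (step s j) ∂μ ≤ σ * V s) (n : ℕ) :
    ∫⁻ ω, V (runAutomaton step s₀ (fun i => c i ω) n) ∂P ≤ σ ^ n * V s₀ := by
  have hrun : ∀ (c : ℕ → ℕ) n, I (runAutomaton step s₀ c n) := by
    intro c n
    induction n with
    | zero => exact hI₀
    | succ n ih => exact hI _ _ ih
  induction n with
  | zero => simp [runAutomaton]
  | succ n ih =>
    have hμ : IsProbabilityMeasure μ := by
      rw [← hlaw 0]; exact Measure.isProbabilityMeasure_map (hc 0)
    have hmeas := aemeasurable_runAutomaton hc step s₀ n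
    have hindep : IndepFun (fun ω => runAutomaton step s₀ (fun i => c i ω) n) (c n) P := by
      obtain ⟨F, hF⟩ := exists_runAutomaton_eq step s₀ n
      simp only [hF]
      exact (hind.indepFun_finset₀ (Finset.range n) {n} (by simp) hc).comp
        (φ := F) (ψ := fun v => v ⟨n, Finset.mem_singleton_self n⟩)
        Measurable.of_discrete Measurable.of_discrete
    have hprod := (indepFun_iff_map_prod_eq_prod_map_map hmeas (hc n)).1 hindep
    rw [hlaw n] at hprod
    calc ∫⁻ ω, V (runAutomaton step s₀ (fun i => c i ω) (n + 1)) ∂P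
        = ∫⁻ z, V (step z.1 z.2)
            ∂(P.map fun ω => (runAutomaton step s₀ (fun i => c i ω) n, c n ω)) := by
          rw [lintegral_map' (Measurable.of_discrete
            (f := fun z : S × ℕ => V (step z.1 z.2))).aemeasurable (hmeas.prodMk (hc n))]
          rfl
      _ = ∫⁻ s, ∫⁻ j, V (step s j) ∂μ
            ∂(P.map fun ω => runAutomaton step s₀ (fun i => c i ω) n) := by
          rw [hprod, lintegral_prod _ (Measurable.of_discrete
            (f := fun z : S × ℕ => V (step z.1 z.2))).aemeasurable]
      _ = ∫⁻ ω, ∫⁻ j, V (step (runAutomaton step s₀ (fun i => c i ω) n) j) ∂μ ∂P := by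
          rw [lintegral_map' (Measurable.of_discrete
            (f := fun s => ∫⁻ j, V (step s j) ∂μ)).aemeasurable hmeas]
      _ ≤ ∫⁻ ω, σ * V (runAutomaton step s₀ (fun i => c i ω) n) ∂P :=
          lintegral_mono fun ω => hV _ (hrun _ _)
      _ = σ * ∫⁻ ω, V (runAutomaton step s₀ (fun i => c i ω) n) ∂P :=
          lintegral_const_mul'' _ ((Measurable.of_discrete (f := V)).comp_aemeasurable hmeas)
      _ ≤ σ * (σ ^ n * V s₀) := by gcongr
      _ = σ ^ (n + 1) * V s₀ := by rw [pow_succ' σ n, mul_assoc]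

end Automaton

/-! ### Integrals against the Poisson law. -/

section Poisson

theorem lintegral_poissonMeasure_of_hasSum {r : ℝ≥0} {f : ℕ → ℝ} (hf : ∀ n, 0 ≤ f n) {s : ℝ}
    (hs : HasSum (fun n : ℕ => Real.exp (-r) * r ^ n / (n.factorial : ℝ) * f n) s) :
    ∫⁻ n, ENNReal.ofReal (f n) ∂(poissonMeasure r) = ENNReal.ofReal s := by
  rw [lintegral_countable', ← hs.tsum_eq, ENNReal.ofReal_tsum_of_nonneg _ hs.summable]
  · refine tsum_congr fun n => ?_
    rw [poissonMeasure_singleton, mul_comm, ENNReal.ofReal_mul (by positivity)]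
  · intro n
    have := hf n
    positivity

theorem lintegral_pow_poissonMeasure (r : ℝ≥0) {x : ℝ} (hx : 0 ≤ x) :
    ∫⁻ n, ENNReal.ofReal (x ^ n) ∂(poissonMeasure r) = ENNReal.ofReal (Real.exp (r * (x - 1))) := by
  refine lintegral_poissonMeasure_of_hasSum (fun n => pow_nonneg hx n) ?_
  have h := (NormedSpace.expSeries_div_hasSum_exp (r * x : ℝ)).mul_left (Real.exp (-r))
  rw [← Real.exp_eq_exp_ℝ, ← Real.exp_add] at h
  convert! h using 1
  · ext n; rw [mul_pow]; ring
  · ring_nf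

theorem lintegral_poissonMeasure_eq_of_eventually_const (r : ℝ≥0) {f : ℕ → ℝ} (hf : ∀ n, 0 ≤ f n)
    (h2 : ∀ n, f (n + 2) = f 2) :
    ∫⁻ n, ENNReal.ofReal (f n) ∂(poissonMeasure r) = ENNReal.ofReal (Real.exp (-r) * f 0 +
      r * Real.exp (-r) * f 1 + (1 - Real.exp (-r) - r * Real.exp (-r)) * f 2) := by
  refine lintegral_poissonMeasure_of_hasSum hf ?_
  have h := (((hasSum_one_poissonMeasure r).mul_right (f 2)).add
    (hasSum_ite_eq 0 (Real.exp (-r) * (f 0 - f 2)))).add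
    (hasSum_ite_eq 1 (r * Real.exp (-r) * (f 1 - f 2)))
  convert! h using 1
  · ext n
    match n with
    | 0 => simp; ring
    | 1 => simp; ring
    | n + 2 => simp [h2]
  · ring

end Poisson

/-! ### The potential of the slot automaton. -/

/-- An exponential potential on the states of the slot automaton: every lagger counts with weight
`x` and every loner with weight `y`; `q` is the probability that a slot is empty. -/
noncomputable def slotPotential (u q x y : ℝ) : SlotState → ℝ
  | (0, _, i, j) => x ^ i * y ^ j
  | (r + 1, false, i, j) => (u - (u - 1) * q ^ (r + 1)) * (x ^ i * y ^ j)
  | (r + 1, true, i, j) => (u - (u - y) * q ^ (r + 1)) * (x ^ i * y ^ j)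

section Potential

variable {m : ℕ} {q p ρ u b x y : ℝ}

theorem slotPotential_false (r i j : ℕ) :
    slotPotential u q x y (r, false, i, j) = (u - (u - 1) * q ^ r) * (x ^ i * y ^ j) := by
  cases r <;> simp [slotPotential]

/-- With `r` empty slots still to come, the potential averages two outcomes: with probability `q ^
r` they all are empty and the factor is `1` (or `y`, if a loner is completed), otherwise the factor
is `u`. Here `b` is the factor after a reset, and `u = (1 + ρ) * b` overcharges a reset just enough
to give the decay `ρ * (1 - q)` in all waiting states. In the state `r = 0` the decay is the
hypothesis `hC`, where `p` is the probability of a single honest block. -/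
theorem slotPotential_drift (hm : 0 < m) (hq0 : 0 < q) (hq1 : q ≤ 1) (hρ : 0 ≤ ρ)
    (hb : 1 ≤ b) (hu : u = (1 + ρ) * b) (hub : u - (u - 1) * q ^ m = b) (hx : 0 ≤ x) (hy : 0 ≤ y)
    (hy1 : y ≤ 1)
    (hC : p * (x * (u - (u - y) * q ^ m)) + (1 - q - p) * b ≤ (1 - q) * (1 - ρ))
    {s : SlotState} (hs : s.1 ≤ m) :
    q * slotPotential u q x y (slotStep m s 0) + p * slotPotential u q x y (slotStep m s 1) +
      (1 - q - p) * slotPotential u q x y (slotStep m s 2) ≤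
      (1 - ρ * (1 - q)) * slotPotential u q x y s := by
  obtain ⟨r, f, i, j⟩ := s
  dsimp only at hs
  have hw : 0 ≤ x ^ i * y ^ j := by positivity
  have hu1 : 1 ≤ u := by rw [hu]; nlinarith
  have hfresh : slotPotential u q x y (m, false, i, j) = b * (x ^ i * y ^ j) := by
    rw [slotPotential_false, hub]
  have hmono : ∀ z, z ≤ 1 → r ≤ m → u - (u - z) * q ^ r ≤ b := by
    intro z hz hr
    have h1 : q ^ m ≤ q ^ r := pow_le_pow_of_le_one hq0.le hq1 hr
    have h2 : 0 < q ^ r := by positivity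
    rw [← hub]
    nlinarith
  match r, f with
  | 0, f =>
    obtain ⟨m, rfl⟩ : ∃ n, m = n + 1 := ⟨m - 1, by omega⟩
    have e1 : slotStep (m + 1) (0, f, i, j) 2 = (m + 1, false, i, j) := rfl
    rw [e1, hfresh]
    simp only [slotStep, slotPotential]
    rw [pow_succ x]
    have := mul_le_mul_of_nonneg_right hC hw
    linarith
  | r + 1, f =>
    have e1 : slotStep m (r + 1, f, i, j) 1 = (m, false, i, j) := slotStep_succ_succ m r f i j 0
    have e2 : slotStep m (r + 1, f, i, j) 2 = (m, false, i, j) := slotStep_succ_succ m r f i j 1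
    rw [e1, e2, hfresh]
    obtain ⟨z, hz, hz1, hz2⟩ : ∃ z, z ≤ 1 ∧ slotPotential u q x y (r + 1, f, i, j) =
        (u - (u - z) * q ^ (r + 1)) * (x ^ i * y ^ j) ∧
        slotPotential u q x y (slotStep m (r + 1, f, i, j) 0) =
          (u - (u - z) * q ^ r) * (x ^ i * y ^ j) := by
      match r, f with
      | r, false => exact ⟨1, le_rfl, rfl, by rw [slotStep_succ_false_zero, slotPotential_false]⟩
      | 0, true =>
        refine ⟨y, hy1, rfl, ?_⟩
        simp only [slotStep, slotPotential]
        ring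
      | r + 1, true => exact ⟨y, hy1, rfl, rfl⟩
    rw [hz1, hz2]
    have h := mul_le_mul_of_nonneg_left (hmono z hz hs) (mul_nonneg hρ (by linarith : 0 ≤ 1 - q))
    -- Before decay the two sides differ by exactly `ρ * (1 - q) * b`, and `b` dominates the current
    -- factor by `hmono`.
    have h' : q * (u - (u - z) * q ^ r) + (1 - q) * b ≤
        (1 - ρ * (1 - q)) * (u - (u - z) * q ^ (r + 1)) := by
      rw [pow_succ] at h ⊢
      have : u * (1 - q) = (1 - q) * b + ρ * (1 - q) * b := by rw [hu]; ring
      linarith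
    have := mul_le_mul_of_nonneg_right h' hw
    linarith

/-- The factor `y` accounts for a pending lagger, whose loner weight may already be charged in the
potential. -/
theorem le_slotPotential (hq0 : 0 < q) (hq1 : q ≤ 1) (hu : 1 ≤ u) (hx : 0 ≤ x) (hy : 0 ≤ y)
    (hy1 : y ≤ 1) (s : SlotState) :
    y * (x ^ s.2.2.1 * y ^ s.2.2.2) ≤ slotPotential u q x y s := by
  obtain ⟨r, f, i, j⟩ := s
  dsimp only
  have hw : 0 ≤ x ^ i * y ^ j := by positivity
  have aux : ∀ z, y ≤ z → z ≤ 1 → y ≤ u - (u - z) * q ^ r := by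
    intro z hz hz1
    have h1 : q ^ r ≤ 1 := pow_le_one₀ hq0.le hq1
    nlinarith
  match r, f with
  | 0, f => exact mul_le_of_le_one_left hw hy1
  | r + 1, false => exact mul_le_mul_of_nonneg_right (aux 1 hy1 le_rfl) hw
  | r + 1, true => exact mul_le_mul_of_nonneg_right (aux y le_rfl hy1) hw

theorem slotStep_fst_le (m : ℕ) {s : SlotState} (c : ℕ) (hs : s.1 ≤ m) :
    (slotStep m s c).1 ≤ m := by
  obtain ⟨r, f, i, j⟩ := s
  dsimp only at hs
  match r, f, c with
  | 0, _, 0 => exact hs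
  | 0, _, 1 => exact le_rfl
  | 0, _, _ + 2 => exact le_rfl
  | 1, true, 0 => exact Nat.zero_le _
  | r + 2, true, 0 => exact (Nat.le_succ _).trans hs
  | r + 1, false, 0 =>
    rw [slotStep_succ_false_zero]
    exact (Nat.le_succ _).trans hs
  | r + 1, f, c + 1 => rw [slotStep_succ_succ]

theorem slotStep_add_two (m : ℕ) (s : SlotState) (c : ℕ) :
    slotStep m s (c + 2) = slotStep m s 2 := by
  obtain ⟨r, f, i, j⟩ := s
  match r with
  | 0 => rfl
  | r + 1 => rw [slotStep_succ_succ, slotStep_succ_succ]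

/-- The joint exponential moment of the numbers of laggers and loners seen by the slot automaton
when the slots are filled independently with Poisson numbers of honest blocks. -/
theorem lintegral_slot_le {Ω : Type*} [MeasurableSpace Ω] {P : Measure Ω} [IsProbabilityMeasure P]
    {c : ℕ → Ω → ℕ} (hc : ∀ i, AEMeasurable (c i) P) (hind : iIndepFun c P) {τ : ℝ≥0}
    (hlaw : ∀ i, P.map (c i) = poissonMeasure τ) (hm : 0 < m) (hq : q = Real.exp (-τ))
    (hp : p = τ * q) (hρ : 0 ≤ ρ) (hρ1 : ρ ≤ 1)
    (hb : 1 ≤ b) (hu : u = (1 + ρ) * b) (hub : u - (u - 1) * q ^ m = b) (hx : 0 ≤ x) (hy : 0 < y)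
    (hy1 : y ≤ 1)
    (hC : p * (x * (u - (u - y) * q ^ m)) + (1 - q - p) * b ≤ (1 - q) * (1 - ρ)) (n : ℕ) :
    ∫⁻ ω, ENNReal.ofReal
      (x ^ (runAutomaton (slotStep m) (m, false, 0, 0) (fun i => c i ω) n).2.2.1 *
        y ^ (runAutomaton (slotStep m) (m, false, 0, 0) (fun i => c i ω) n).2.2.2) ∂P ≤
      ENNReal.ofReal (b / y * Real.exp (-(ρ * ((1 - q) * n)))) := by
  have hq0 : 0 < q := hq ▸ Real.exp_pos _
  have hq1 : q ≤ 1 := by rw [hq]; exact Real.exp_le_one_iff.2 (by simp)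
  have hu1 : 1 ≤ u := by rw [hu]; nlinarith
  have hpos : ∀ s, 0 ≤ slotPotential u q x y s := fun s =>
    le_trans (by positivity) (le_slotPotential hq0 hq1 hu1 hx hy.le hy1 s)
  have hσ : 0 ≤ 1 - ρ * (1 - q) := by nlinarith
  have hmain := lintegral_runAutomaton_le hc hind hlaw (step := slotStep m)
    (s₀ := (m, false, 0, 0)) (I := fun s => s.1 ≤ m) le_rfl (fun s j hs => slotStep_fst_le m j hs)
    (V := fun s => ENNReal.ofReal (slotPotential u q x y s))
    (σ := ENNReal.ofReal (1 - ρ * (1 - q))) (fun s hs => by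
      rw [lintegral_poissonMeasure_eq_of_eventually_const τ (fun n => hpos _)
        (fun n => by rw [slotStep_add_two]), ← ENNReal.ofReal_mul hσ, ← hq, ← hp]
      exact ENNReal.ofReal_le_ofReal
        (slotPotential_drift hm hq0 hq1 hρ hb hu hub hx hy.le hy1 hC hs)) n
  rw [slotPotential_false, hub, ← ENNReal.ofReal_pow hσ, ← ENNReal.ofReal_mul (by positivity)]
    at hmain
  calc _ ≤ ∫⁻ ω, ENNReal.ofReal y⁻¹ * ENNReal.ofReal (slotPotential u q x y
          (runAutomaton (slotStep m) (m, false, 0, 0) (fun i => c i ω) n)) ∂P := by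
        refine lintegral_mono fun ω => ?_
        rw [← ENNReal.ofReal_mul (by positivity)]
        refine ENNReal.ofReal_le_ofReal ?_
        rw [inv_mul_eq_div, le_div_iff₀ hy, mul_comm]
        exact le_slotPotential hq0 hq1 hu1 hx hy.le hy1 _
    _ = ENNReal.ofReal y⁻¹ * ∫⁻ ω, ENNReal.ofReal (slotPotential u q x y
          (runAutomaton (slotStep m) (m, false, 0, 0) (fun i => c i ω) n)) ∂P :=
        lintegral_const_mul' _ _ ENNReal.ofReal_ne_top
    _ ≤ ENNReal.ofReal y⁻¹ * ENNReal.ofReal ((1 - ρ * (1 - q)) ^ n * (b * (x ^ 0 * y ^ 0))) := by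
        gcongr
    _ ≤ _ := by
        rw [← ENNReal.ofReal_mul (by positivity)]
        refine ENNReal.ofReal_le_ofReal ?_
        have h1 : (1 - ρ * (1 - q)) ^ n ≤ Real.exp (-(ρ * ((1 - q) * n))) := by
          have h2 : 1 - ρ * (1 - q) ≤ Real.exp (-(ρ * (1 - q))) := by
            linarith [Real.add_one_le_exp (-(ρ * (1 - q)))]
          calc _ ≤ Real.exp (-(ρ * (1 - q))) ^ n := pow_le_pow_left₀ hσ h2 n
            _ = _ := by rw [← Real.exp_nat_mul]; ring_nf
        calc _ = b / y * (1 - ρ * (1 - q)) ^ n := by simp; ring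
          _ ≤ _ := by gcongr

end Potential

/-! ### Lower tails of the lagger and loner counts. -/

theorem BlockTree.numHonest_sub (B : BlockTree) {s t : ℝ} (hs : 0 ≤ s) (hst : s ≤ t) :
    B.numHonest 0 t - B.numHonest 0 s = B.numHonest s t := by
  have hu : {k | B.honest k ∧ B.time k ∈ Ioc 0 t} =
      {k | B.honest k ∧ B.time k ∈ Ioc 0 s} ∪ {k | B.honest k ∧ B.time k ∈ Ioc s t} := by
    ext k
    have h : B.time k ∈ Ioc 0 t ↔ B.time k ∈ Ioc 0 s ∨ B.time k ∈ Ioc s t := by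
      rw [← mem_union, Ioc_union_Ioc_eq_Ioc hs hst]
    simp only [mem_ofPred_eq, mem_union, h]
    tauto
  have hd : Disjoint {k | B.honest k ∧ B.time k ∈ Ioc 0 s} {k | B.honest k ∧ B.time k ∈ Ioc s t} :=
    Set.disjoint_left.2 fun k h1 h2 => h1.2.2.not_gt h2.2.1
  have := Set.ncard_union_eq hd (B.finite_time_mem_Ioc _ _ _) (B.finite_time_mem_Ioc _ _ _)
  rw [← hu] at this
  unfold BlockTree.numHonest
  omega

/-- Markov's inequality for an exponential moment. -/
theorem measure_le_ofReal_of_lintegral_le {Ω : Type*} [MeasurableSpace Ω] {P : Measure Ω}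
    {f : Ω → ℝ} {K L : ℝ} (hL : 0 < L) (hf : AEMeasurable f P)
    (hK : ∫⁻ ω, ENNReal.ofReal (f ω) ∂P ≤ ENNReal.ofReal K) {A : Set Ω} (hA : ∀ ω ∈ A, L ≤ f ω) :
    P A ≤ ENNReal.ofReal (K / L) := by
  have h1 : P A ≤ P {ω | ENNReal.ofReal L ≤ ENNReal.ofReal (f ω)} :=
    measure_mono fun ω hω => ENNReal.ofReal_le_ofReal (hA ω hω)
  have h2 := meas_ge_le_lintegral_div hf.ennreal_ofReal (ε := ENNReal.ofReal L) (by simpa using hL)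
    ENNReal.ofReal_ne_top
  refine h1.trans (h2.trans ?_)
  rw [ENNReal.ofReal_div_of_pos hL]
  gcongr

namespace MiningSystem

variable {Ω : Type*} [MeasurableSpace Ω] {P : Measure Ω} {α β Δ : ℝ}

/-- The numbers of honest blocks in consecutive time slots of length `h` are independent Poisson
variables. -/
theorem slots_iIndepFun (S : MiningSystem P α β Δ) {a h : ℝ} (ha : 0 ≤ a) (hh : 0 < h) :
    iIndepFun (fun (i : ℕ) ω => (S.out ω).numHonest (a + i * h) (a + (i + 1) * h)) P ∧
    ∀ i : ℕ, HasLaw (fun ω => (S.out ω).numHonest (a + i * h) (a + (i + 1) * h))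
      (poissonMeasure (α * h).toNNReal) P := by
  constructor
  · have hmono : Monotone fun i : ℕ => (⟨a + i * h, by positivity⟩ : ℝ≥0) := by
      intro i j hij
      have : (i : ℝ) ≤ j := by exact_mod_cast hij
      exact Subtype.mk_le_mk.2 (by gcongr)
    have hind := S.indep_increments.nat hmono
    convert! hind using 3 with i ω
    have hi : a + i * h ≤ a + (i + 1) * h := by nlinarith
    rw [← BlockTree.numHonest_sub _ (by positivity) hi]
    push_cast
    rfl
  · intro i
    have hl := S.poisson_increments (a + i * h) (a + (i + 1) * h) (by positivity) (by nlinarith)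
    convert hl using 3
    ring

variable [IsProbabilityMeasure P]

/-- As `x, y ≤ 1`, undercounting only enlarges the weight, so Markov's inequality may be applied to
the automaton, whose counters are a.e. measurable. The `- 1` is for the incomplete last slot. -/
theorem measure_counts_le (S : MiningSystem P α β Δ) {a ℓ h b q p ρ u x y : ℝ} {m : ℕ} (hα : 0 < α)
    (ha : 0 ≤ a) (hℓ : 0 ≤ ℓ) (hh : 0 < h) (hm : 0 < m) (hmh : m * h = Δ)
    (hq : q = Real.exp (-(α * h))) (hp : p = α * h * q) (hρ : 0 ≤ ρ) (hρ1 : ρ ≤ 1)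
    (hb : 1 ≤ b) (hu : u = (1 + ρ) * b) (hub : u - (u - 1) * q ^ m = b) (hx : 0 < x) (hx1 : x ≤ 1)
    (hy : 0 < y) (hy1 : y ≤ 1)
    (hC : p * (x * (u - (u - y) * q ^ m)) + (1 - q - p) * b ≤ (1 - q) * (1 - ρ))
    {L : ℝ} (hL : 0 < L) :
    P {ω | L ≤ x ^ (S.out ω).numLagger Δ a (a + ℓ) * y ^ (S.out ω).numLoner Δ a (a + ℓ)} ≤
      ENNReal.ofReal (b / y * Real.exp (-(ρ * ((1 - q) * (ℓ / h - 1)))) / L) := by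
  obtain ⟨hind, hlaw⟩ := S.slots_iIndepFun ha hh
  have hτ : ((α * h).toNNReal : ℝ) = α * h := Real.coe_toNNReal _ (by positivity)
  have hc := fun i => (hlaw i).aemeasurable
  have hint := lintegral_slot_le hc hind (fun i => (hlaw i).map_eq) hm (by rw [hτ, hq])
    (by rw [hτ, hp]) hρ hρ1 hb hu hub hx.le hy hy1 hC ⌊ℓ / h⌋₊
  have hmeas : AEMeasurable (fun ω => x ^ (runAutomaton (slotStep m) (m, false, 0, 0)
      (fun i => (S.out ω).numHonest (a + i * h) (a + (i + 1) * h)) ⌊ℓ / h⌋₊).2.2.1 *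
      y ^ (runAutomaton (slotStep m) (m, false, 0, 0)
      (fun i => (S.out ω).numHonest (a + i * h) (a + (i + 1) * h)) ⌊ℓ / h⌋₊).2.2.2) P :=
    (Measurable.of_discrete (f := fun s : SlotState => x ^ s.2.2.1 * y ^ s.2.2.2)).comp_aemeasurable
      (aemeasurable_runAutomaton hc (slotStep m) (m, false, 0, 0) ⌊ℓ / h⌋₊)
  have hq1 : q ≤ 1 := by rw [hq]; exact Real.exp_le_one_iff.2 (by simp; positivity)
  refine (measure_le_ofReal_of_lintegral_le hL hmeas hint fun ω hω => ?_).trans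
    (ENNReal.ofReal_le_ofReal ?_)
  · obtain ⟨h1, h2⟩ := BlockTree.runAutomaton_slotStep_le (B := S.out ω) (a := a) hm hh hmh ⌊ℓ / h⌋₊
    have hend : a + ⌊ℓ / h⌋₊ * h ≤ a + ℓ := by
      have := mul_le_mul_of_nonneg_right (Nat.floor_le (div_nonneg hℓ hh.le)) hh.le
      rw [div_mul_cancel₀ _ hh.ne'] at this
      linarith
    have h1' := h1.trans ((S.out ω).ncard_time_mem_mono _ le_rfl hend)
    have h2' := h2.trans ((S.out ω).ncard_time_mem_mono _ le_rfl hend)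
    exact (show L ≤ _ from hω).trans (mul_le_mul (pow_le_pow_of_le_one hx.le hx1 h1')
      (pow_le_pow_of_le_one hy.le hy1 h2') (by positivity) (by positivity))
  · have : ℓ / h - 1 ≤ ⌊ℓ / h⌋₊ := by linarith [Nat.lt_floor_add_one (ℓ / h)]
    have h1q : 0 ≤ 1 - q := by linarith
    gcongr

/-- A slot length for which the discretization error is negligible. -/
theorem exists_slot {α Δ θ : ℝ} (hα : 0 < α) (hΔ : 0 < Δ) (hθ : 0 < θ) :
    ∃ (m : ℕ) (h : ℝ), 0 < m ∧ 0 < h ∧ m * h = Δ ∧ α * h ≤ θ / 2 ∧ h ≤ θ / 2 := by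
  obtain ⟨m, hm⟩ := exists_nat_gt ((α + 1) * Δ / (θ / 2))
  have hmpos : (0 : ℝ) < m := lt_trans (by positivity) hm
  have hle : (α + 1) * (Δ / m) ≤ θ / 2 := by
    rw [div_lt_iff₀ (by positivity)] at hm
    rw [← mul_div_assoc, div_le_iff₀ hmpos]
    linarith
  have hpos : 0 < Δ / m := by positivity
  refine ⟨m, Δ / m, by exact_mod_cast hmpos, hpos, by field_simp, ?_, ?_⟩ <;> nlinarith

theorem one_sub_exp_neg_bounds {θ : ℝ} (hθ : 0 ≤ θ) (hθ1 : θ ≤ 1) :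
    θ * (1 - θ / 2) ≤ 1 - Real.exp (-θ) ∧ 1 - θ ≤ Real.exp (-θ) := by
  refine ⟨?_, by linarith [Real.add_one_le_exp (-θ)]⟩
  have h1 := Real.quadratic_le_exp_of_nonneg hθ
  have h2 : (1 - θ * (1 - θ / 2)) * (1 + θ + θ ^ 2 / 2) ≥ 1 := by nlinarith [pow_nonneg hθ 4]
  have h3 : Real.exp (-θ) * Real.exp θ = 1 := by rw [← Real.exp_add]; simp
  by_contra! hlt
  have h4 : 0 < 1 - θ * (1 - θ / 2) := by nlinarith
  have h5 := Real.exp_pos (-θ)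
  nlinarith

section Bounds

variable {g ρ θ : ℝ}

/-- With `g = q ^ m`, the equations `u = (1 + ρ) * b` and `b = u - (u - 1) * g` force `b = g / (g -
ρ * (1 - g))`. -/
theorem slot_start_bounds (hg : 0 < g) (hg1 : g ≤ 1) (hθ1 : θ ≤ 1 / 12) (hρ : 0 ≤ ρ)
    (hρg : ρ ≤ g * θ) :
    ∃ b, 1 ≤ b ∧ b * (g - ρ * (1 - g)) = g ∧ b ≤ 12 / 11 ∧ g * (1 - θ) ≤ g - ρ * (1 - g) ∧
      (1 + ρ) * b - ((1 + ρ) * b - 1) * g = b := by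
  have hD : g * (1 - θ) ≤ g - ρ * (1 - g) := by nlinarith
  have hD0 : 0 < g - ρ * (1 - g) := lt_of_lt_of_le (by nlinarith) hD
  have hb : g / (g - ρ * (1 - g)) * (g - ρ * (1 - g)) = g := div_mul_cancel₀ _ hD0.ne'
  refine ⟨g / (g - ρ * (1 - g)), ?_, hb, ?_, hD, ?_⟩
  · rw [le_div_iff₀ hD0]; nlinarith
  · rw [div_le_iff₀ hD0]; nlinarith
  · linarith

theorem slot_rate_le {α h ℓ q : ℝ} (hα : 0 < α) (hh : 0 < h) (hθ1 : θ ≤ 1 / 12)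
    (hαh : α * h ≤ θ / 2) (hhθ : h ≤ θ / 2) (hℓ : 1 ≤ ℓ) (hq : q = Real.exp (-(α * h))) :
    α * ℓ * (1 - θ) ≤ (1 - q) * (ℓ / h - 1) := by
  have hαh0 : 0 < α * h := mul_pos hα hh
  have h1 := (one_sub_exp_neg_bounds hαh0.le (by linarith)).1
  rw [← hq] at h1
  have h2 : 0 ≤ ℓ / h - 1 := by
    rw [sub_nonneg, le_div_iff₀ hh]; linarith
  calc α * ℓ * (1 - θ) ≤ α * ((1 - θ / 4) * (ℓ * (1 - θ / 2))) := by
        rw [mul_assoc]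
        refine mul_le_mul_of_nonneg_left ?_ hα.le
        nlinarith [mul_nonneg (by linarith : 0 ≤ θ) (by linarith : 0 ≤ ℓ),
          mul_nonneg (sq_nonneg θ) (by linarith : 0 ≤ ℓ)]
    _ ≤ α * ((1 - θ / 4) * (ℓ - h)) := by
        refine mul_le_mul_of_nonneg_left (mul_le_mul_of_nonneg_left ?_ (by linarith)) hα.le
        nlinarith
    _ = α * h * (1 - θ / 4) * (ℓ / h - 1) := by field_simp
    _ ≤ α * h * (1 - α * h / 2) * (ℓ / h - 1) := by
        refine mul_le_mul_of_nonneg_right (mul_le_mul_of_nonneg_left ?_ hαh0.le) h2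
        linarith
    _ ≤ _ := mul_le_mul_of_nonneg_right h1 h2

/-- In short slots, nearly every nonempty slot holds exactly one honest block. -/
theorem slot_singleton_bounds {α h q : ℝ} (hα : 0 < α) (hh : 0 < h) (hθ : 0 < θ)
    (hθ1 : θ ≤ 1 / 12) (hαh : α * h ≤ θ / 2) (hq : q = Real.exp (-(α * h))) :
    0 ≤ 1 - q ∧ (1 - q) * (θ * (1 - θ)) ≤ α * h * q * (1 - Real.exp (-θ)) := by
  have hαh0 : 0 < α * h := mul_pos hα hh
  have h0 := (one_sub_exp_neg_bounds hαh0.le (by linarith)).2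
  have h1 := (one_sub_exp_neg_bounds hθ.le (by linarith)).1
  have h2 : 0 ≤ 1 - q := by
    rw [hq, sub_nonneg]; exact Real.exp_le_one_iff.2 (by linarith)
  rw [← hq] at h0
  refine ⟨h2, ?_⟩
  calc (1 - q) * (θ * (1 - θ)) ≤ (1 - q) * ((1 - θ / 2) * (θ * (1 - θ / 2))) := by
        refine mul_le_mul_of_nonneg_left ?_ h2
        nlinarith [pow_nonneg hθ.le 3]
    _ = ((1 - q) * (1 - θ / 2)) * (θ * (1 - θ / 2)) := by ring
    _ ≤ (α * h * q) * (1 - Real.exp (-θ)) := by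
        refine mul_le_mul (mul_le_mul ?_ ?_ ?_ hαh0.le) h1 ?_ ?_
        · linarith
        · linarith
        · linarith
        · nlinarith
        · have : 0 < q := hq ▸ Real.exp_pos _
          positivity

end Bounds

theorem measure_numLagger_le (S : MiningSystem P α β Δ) (hα : 0 < α) (hΔ : 0 < Δ) {a ℓ θ : ℝ}
    (ha : 0 ≤ a) (hℓ : 1 ≤ ℓ) (hθ : 0 < θ) (hθ1 : θ ≤ 1 / 12) (c : ℝ) :
    P {ω | ((S.out ω).numLagger Δ a (a + ℓ) : ℝ) ≤ c} ≤
      ENNReal.ofReal (2 * Real.exp (θ * c -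
        discount α Δ * (θ * (1 - 2 * θ)) * (α * ℓ * (1 - θ)))) := by
  obtain ⟨m, h, hm, hh, hmh, hαh, hhθ⟩ := exists_slot hα hΔ hθ
  set g := discount α Δ with hgdef
  have hg : 0 < g := Real.exp_pos _
  have hg1 : g ≤ 1 := Real.exp_le_one_iff.2 (by simp; positivity)
  set q := Real.exp (-(α * h)) with hq
  have hqm : q ^ m = g := by
    rw [hq, ← Real.exp_nat_mul, hgdef, discount, ← hmh]; ring_nf
  -- To first order in `θ`, `hC` with `y = 1` reads `ρ / g ≤ θ`; the factor `1 - 2 * θ` absorbs the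
  -- errors.
  set ρ := g * (θ * (1 - 2 * θ)) with hρ
  have h2θ : 0 ≤ θ * (1 - 2 * θ) := by nlinarith
  have hρ0 : 0 ≤ ρ := by positivity
  have hρg : ρ ≤ g * θ := mul_le_mul_of_nonneg_left (by nlinarith) hg.le
  obtain ⟨b, hb1, hbeq, hb2, hD, hub⟩ := slot_start_bounds hg hg1 hθ1 hρ0 hρg
  obtain ⟨h1q, hs⟩ := slot_singleton_bounds hα hh hθ hθ1 hαh hq
  have hrate := slot_rate_le hα hh hθ1 hαh hhθ hℓ hq
  have hC : α * h * q * (Real.exp (-θ) * ((1 + ρ) * b - ((1 + ρ) * b - 1) * q ^ m)) +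
      (1 - q - α * h * q) * b ≤ (1 - q) * (1 - ρ) := by
    rw [hqm, hub]
    have h1 : b * (1 - θ * (1 - θ)) ≤ 1 - ρ := by
      have hD0 : 0 < g - ρ * (1 - g) := lt_of_lt_of_le (by nlinarith) hD
      refine le_of_mul_le_mul_right ?_ hD0
      have h3 : ρ ≤ g * (θ * (1 - θ)) := mul_le_mul_of_nonneg_left (by nlinarith) hg.le
      calc b * (1 - θ * (1 - θ)) * (g - ρ * (1 - g)) = g * (1 - θ * (1 - θ)) := by
            rw [mul_right_comm, hbeq]
        _ ≤ g - ρ + ρ ^ 2 * (1 - g) := by nlinarith [mul_nonneg (sq_nonneg ρ) (sub_nonneg.2 hg1)]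
        _ = _ := by ring
    have h2 := mul_le_mul_of_nonneg_left h1 h1q
    have h3 := mul_le_mul_of_nonneg_left hs (by linarith : 0 ≤ b)
    linarith
  have hmain := S.measure_counts_le (ℓ := ℓ) (x := Real.exp (-θ)) (y := 1) hα ha (by linarith) hh hm
    hmh hq rfl hρ0 (by nlinarith) hb1 rfl (hqm.symm ▸ hub) (Real.exp_pos _)
    (Real.exp_le_one_iff.2 (by linarith)) one_pos le_rfl hC (Real.exp_pos (-(θ * c)))
  refine (measure_mono fun ω hω => ?_).trans (hmain.trans (ENNReal.ofReal_le_ofReal ?_))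
  · have hω' : ((S.out ω).numLagger Δ a (a + ℓ) : ℝ) ≤ c := hω
    change Real.exp (-(θ * c)) ≤ _
    rw [one_pow, mul_one, ← Real.exp_nat_mul, Real.exp_le_exp]
    nlinarith
  · have e : θ * c - ρ * (α * ℓ * (1 - θ)) = -(ρ * (α * ℓ * (1 - θ))) - -(θ * c) := by ring
    rw [e, Real.exp_sub, div_one, ← mul_div_assoc]
    have : b ≤ 2 := by linarith
    gcongr

theorem measure_numLoner_le (S : MiningSystem P α β Δ) (hα : 0 < α) (hΔ : 0 < Δ) {a ℓ θ : ℝ}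
    (ha : 0 ≤ a) (hℓ : 1 ≤ ℓ) (hθ : 0 < θ) (hθ1 : θ ≤ 1 / 12) (c : ℝ) :
    P {ω | ((S.out ω).numLoner Δ a (a + ℓ) : ℝ) ≤ c} ≤
      ENNReal.ofReal (2 * Real.exp (θ * c -
        discount α Δ ^ 2 * (θ * (1 - 2 * θ)) * (α * ℓ * (1 - θ)))) := by
  obtain ⟨m, h, hm, hh, hmh, hαh, hhθ⟩ := exists_slot hα hΔ hθ
  set g := discount α Δ with hgdef
  have hg : 0 < g := Real.exp_pos _
  have hg1 : g ≤ 1 := Real.exp_le_one_iff.2 (by simp; positivity)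
  set q := Real.exp (-(α * h)) with hq
  have hqm : q ^ m = g := by
    rw [hq, ← Real.exp_nat_mul, hgdef, discount, ← hmh]; ring_nf
  -- With `x = 1` and the weight on loners, `hC` becomes `ρ / g ≤ g * θ` to first order, whence the
  -- second factor `g`.
  set ρ := g ^ 2 * (θ * (1 - 2 * θ)) with hρ
  have h2θ : 0 ≤ θ * (1 - 2 * θ) := by nlinarith
  have hρ0 : 0 ≤ ρ := by positivity
  have hρg : ρ ≤ g * θ := mul_le_mul (by nlinarith) (by nlinarith) h2θ hg.le
  obtain ⟨b, hb1, hbeq, hb2, hD, hub⟩ := slot_start_bounds hg hg1 hθ1 hρ0 hρg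
  obtain ⟨h1q, hs⟩ := slot_singleton_bounds hα hh hθ hθ1 hαh hq
  have hrate := slot_rate_le hα hh hθ1 hαh hhθ hℓ hq
  have hC : α * h * q * (1 * ((1 + ρ) * b - ((1 + ρ) * b - Real.exp (-θ)) * q ^ m)) +
      (1 - q - α * h * q) * b ≤ (1 - q) * (1 - ρ) := by
    have e : (1 + ρ) * b - ((1 + ρ) * b - Real.exp (-θ)) * q ^ m =
        b - g * (1 - Real.exp (-θ)) := by rw [hqm]; linarith
    rw [e, one_mul]
    have h1 : b - g * (θ * (1 - θ)) ≤ 1 - ρ := by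
      have hD0 : 0 < g - ρ * (1 - g) := lt_of_lt_of_le (by nlinarith) hD
      refine le_of_mul_le_mul_right ?_ hD0
      have h3 : ρ ≤ g * (θ * (1 - θ)) * (g * (1 - θ)) := by
        calc ρ ≤ g ^ 2 * (θ * (1 - θ) ^ 2) := by
              refine mul_le_mul_of_nonneg_left (mul_le_mul_of_nonneg_left ?_ hθ.le) (sq_nonneg g)
              nlinarith
          _ = _ := by ring
      have h4 : g * (θ * (1 - θ)) * (g * (1 - θ)) ≤ g * (θ * (1 - θ)) * (g - ρ * (1 - g)) :=
        mul_le_mul_of_nonneg_left hD (mul_nonneg hg.le (mul_nonneg hθ.le (by linarith)))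
      have h5 : 0 ≤ ρ * (ρ * (1 - g)) := mul_nonneg hρ0 (mul_nonneg hρ0 (by linarith))
      linarith
    have h2 := mul_le_mul_of_nonneg_left h1 h1q
    have h3 := mul_le_mul_of_nonneg_left hs hg.le
    linarith
  have hmain := S.measure_counts_le (ℓ := ℓ) (x := 1) (y := Real.exp (-θ)) hα ha (by linarith) hh hm
    hmh hq rfl hρ0 (by nlinarith) hb1 rfl (hqm.symm ▸ hub) one_pos le_rfl (Real.exp_pos _)
    (Real.exp_le_one_iff.2 (by linarith)) hC (Real.exp_pos (-(θ * c)))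
  refine (measure_mono fun ω hω => ?_).trans (hmain.trans (ENNReal.ofReal_le_ofReal ?_))
  · have hω' : ((S.out ω).numLoner Δ a (a + ℓ) : ℝ) ≤ c := hω
    change Real.exp (-(θ * c)) ≤ _
    rw [one_pow, one_mul, ← Real.exp_nat_mul, Real.exp_le_exp]
    nlinarith
  · have e : θ * c - ρ * (α * ℓ * (1 - θ)) = -(ρ * (α * ℓ * (1 - θ))) - -(θ * c) := by ring
    rw [e, Real.exp_sub, ← mul_div_assoc]
    have : b / Real.exp (-θ) ≤ 2 := by
      rw [div_le_iff₀ (Real.exp_pos _)]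
      linarith [(one_sub_exp_neg_bounds hθ.le (by linarith)).2]
    gcongr

end MiningSystem

/-! ### Tails of the honest and adversarial counts. -/

/-- Chernoff's bound for the Poisson series itself, comparing the indicator of `n ≥ N` with `exp (θ
* (n - N))` termwise. The adversarial count is only known through a bound on its distribution
function. -/
theorem one_sub_poisson_cdf_le {r θ : ℝ} (hr : 0 ≤ r) (hθ : 0 ≤ θ) (N : ℕ) :
    1 - Real.exp (-r) * ∑ i ∈ Finset.range N, r ^ i / (i.factorial : ℝ) ≤
      Real.exp (r * (Real.exp θ - 1) - θ * N) := by
  have h1 := hasSum_one_poissonMeasure ⟨r, hr⟩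
  have h2 : HasSum (fun n => if n ∈ Finset.range N then
      Real.exp (-r) * (r ^ n / (n.factorial : ℝ)) else 0)
      (Real.exp (-r) * ∑ i ∈ Finset.range N, r ^ i / (i.factorial : ℝ)) := by
    have h := hasSum_sum_of_ne_finset_zero (L := .unconditional ℕ)
      (f := fun n => if n ∈ Finset.range N then
      Real.exp (-r) * (r ^ n / (n.factorial : ℝ)) else 0) (s := Finset.range N)
      fun n hn => if_neg hn
    rwa [Finset.sum_congr rfl fun n hn => if_pos hn, ← Finset.mul_sum] at h
  have h3 := ((NormedSpace.expSeries_div_hasSum_exp (r * Real.exp θ : ℝ)).mul_left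
    (Real.exp (-r))).mul_left (Real.exp (-(θ * N)))
  rw [← Real.exp_eq_exp_ℝ, ← Real.exp_add, ← Real.exp_add] at h3
  have e : -(θ * N) + (-r + r * Real.exp θ) = r * (Real.exp θ - 1) - θ * N := by ring
  rw [e] at h3
  refine hasSum_le (fun n => ?_) (h1.sub h2) h3
  change Real.exp (-r) * r ^ n / (n.factorial : ℝ) - _ ≤ _
  split_ifs with hn
  · rw [mul_div_assoc, sub_self]
    positivity
  · have hn' : (N : ℝ) ≤ n := by
      rw [Finset.mem_range, not_lt] at hn
      exact_mod_cast hn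
    have h4 : 1 ≤ Real.exp (-(θ * N)) * Real.exp θ ^ n := by
      rw [← Real.exp_nat_mul, ← Real.exp_add]
      exact Real.one_le_exp (by nlinarith)
    rw [sub_zero, mul_pow]
    calc _ = Real.exp (-r) * (r ^ n / (n.factorial : ℝ)) * 1 := by ring
      _ ≤ Real.exp (-r) * (r ^ n / (n.factorial : ℝ)) * (Real.exp (-(θ * N)) * Real.exp θ ^ n) := by
          gcongr
      _ = _ := by ring

/-- At most `n` of the events occur iff each set of `n + 1` indices contains one whose event fails,
a countable condition. It is needed to pass to complements in the bound on the adversarial count. -/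
theorem measurableSet_ncard_le {Ω : Type*} [MeasurableSpace Ω] {Q : ℕ → Set Ω}
    (hQ : ∀ k, MeasurableSet (Q k)) (hfin : ∀ ω, {k | ω ∈ Q k}.Finite) (n : ℕ) :
    MeasurableSet {ω | {k | ω ∈ Q k}.ncard ≤ n} := by
  have : {ω | {k | ω ∈ Q k}.ncard ≤ n} =
      ⋂ F : {F : Finset ℕ // F.card = n + 1}, ⋃ k ∈ F.1, (Q k)ᶜ := by
    ext ω
    simp only [mem_ofPred_eq, mem_iInter, mem_iUnion, mem_compl_iff, exists_prop]
    constructor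
    · rintro h ⟨F, hF⟩
      by_contra! hsub
      have := Set.ncard_le_ncard (s := (F : Set ℕ)) (t := {k | ω ∈ Q k}) (fun k hk => hsub k hk) (hfin ω)
      rw [Set.ncard_coe_finset] at this
      omega
    · intro h
      by_contra! hlt
      obtain ⟨F, hF, hcard⟩ := Finset.exists_subset_card_eq (s := (hfin ω).toFinset) (n := n + 1)
        (by rw [← Set.ncard_eq_toFinset_card _ (hfin ω)]; omega)
      obtain ⟨k, hk, hk'⟩ := h ⟨F, hcard⟩
      exact hk' ((hfin ω).mem_toFinset.1 (hF hk))
  rw [this]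
  exact MeasurableSet.iInter fun F => MeasurableSet.biUnion F.1.countable_toSet
    fun k _ => (hQ k).compl

namespace MiningSystem

variable {Ω : Type*} [MeasurableSpace Ω] {P : Measure Ω} {α β Δ : ℝ}

theorem lintegral_pow_numHonest (S : MiningSystem P α β Δ) (hα : 0 ≤ α) {s t : ℝ} (hs : 0 ≤ s)
    (hst : s < t) (x : ℝ) :
    ∫⁻ ω, ENNReal.ofReal (Real.exp x ^ (S.out ω).numHonest s t) ∂P =
      ENNReal.ofReal (Real.exp (α * (t - s) * (Real.exp x - 1))) := by
  have hl := S.poisson_increments s t hs hst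
  have h := lintegral_pow_poissonMeasure (α * (t - s)).toNNReal (Real.exp_pos x).le
  rw [Real.coe_toNNReal _ (mul_nonneg hα (by linarith)), ← hl.map_eq,
    lintegral_map' (by fun_prop) hl.aemeasurable] at h
  exact h

theorem measure_numHonest_le (S : MiningSystem P α β Δ) (hα : 0 ≤ α) {s t θ : ℝ} (hs : 0 ≤ s)
    (hst : s < t) (hθ : 0 ≤ θ) (c : ℝ) :
    P {ω | ((S.out ω).numHonest s t : ℝ) ≤ c} ≤
      ENNReal.ofReal (Real.exp (α * (t - s) * (Real.exp (-θ) - 1) + θ * c)) := by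
  have hm : AEMeasurable (fun ω => Real.exp (-θ) ^ (S.out ω).numHonest s t) P :=
    (Measurable.of_discrete (f := fun n : ℕ => Real.exp (-θ) ^ n)).comp_aemeasurable
      (S.poisson_increments s t hs hst).aemeasurable
  refine (measure_le_ofReal_of_lintegral_le (Real.exp_pos (-(θ * c))) hm
    (S.lintegral_pow_numHonest hα hs hst (-θ)).le fun ω hω => ?_).trans_eq ?_
  · have hω' : ((S.out ω).numHonest s t : ℝ) ≤ c := hω
    rw [← Real.exp_nat_mul, Real.exp_le_exp]
    nlinarith
  · rw [← Real.exp_sub, sub_neg_eq_add]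

theorem measure_le_numHonest (S : MiningSystem P α β Δ) (hα : 0 ≤ α) {s t θ : ℝ} (hs : 0 ≤ s)
    (hst : s < t) (hθ : 0 ≤ θ) (c : ℝ) :
    P {ω | c ≤ ((S.out ω).numHonest s t : ℝ)} ≤
      ENNReal.ofReal (Real.exp (α * (t - s) * (Real.exp θ - 1) - θ * c)) := by
  have hm : AEMeasurable (fun ω => Real.exp θ ^ (S.out ω).numHonest s t) P :=
    (Measurable.of_discrete (f := fun n : ℕ => Real.exp θ ^ n)).comp_aemeasurable
      (S.poisson_increments s t hs hst).aemeasurable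
  refine (measure_le_ofReal_of_lintegral_le (Real.exp_pos (θ * c)) hm
    (S.lintegral_pow_numHonest hα hs hst θ).le fun ω hω => ?_).trans_eq ?_
  · have hω' : c ≤ ((S.out ω).numHonest s t : ℝ) := hω
    rw [← Real.exp_nat_mul, Real.exp_le_exp]
    nlinarith
  · rw [← Real.exp_sub]

theorem measurableSet_numAdv_le (S : MiningSystem P α β Δ) (s t : ℝ) (n : ℕ) :
    MeasurableSet {ω | (S.out ω).numAdv s t ≤ n} :=
  measurableSet_ncard_le (Q := fun k => {ω | ¬ (S.out ω).honest k ∧ (S.out ω).time k ∈ Ioc s t})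
    (fun k => (S.measurable_honest k).compl.inter (S.measurable_time k measurableSet_Ioc))
    (fun ω => (S.out ω).finite_time_mem_Ioc _ _ _) n

theorem measure_le_numAdv [IsProbabilityMeasure P] (S : MiningSystem P α β Δ) (hβ : 0 ≤ β)
    {s t θ : ℝ} (hs : 0 ≤ s) (hst : s < t) (hθ : 0 ≤ θ) (c : ℝ) :
    P {ω | c ≤ ((S.out ω).numAdv s t : ℝ)} ≤
      ENNReal.ofReal (Real.exp (β * (t - s) * (Real.exp θ - 1) - θ * c)) := by
  have hr : 0 ≤ β * (t - s) := mul_nonneg hβ (by linarith)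
  have hexp : 1 ≤ Real.exp θ := Real.one_le_exp hθ
  rcases le_or_gt c 0 with hc | hc
  · refine prob_le_one.trans ?_
    rw [← ENNReal.ofReal_one]
    refine ENNReal.ofReal_le_ofReal (Real.one_le_exp ?_)
    nlinarith [mul_nonneg hr (sub_nonneg.2 hexp)]
  obtain ⟨n, hn⟩ : ∃ n, ⌈c⌉₊ = n + 1 := ⟨⌈c⌉₊ - 1, by have := Nat.ceil_pos.2 hc; omega⟩
  have hset : {ω | c ≤ ((S.out ω).numAdv s t : ℝ)} = {ω | (S.out ω).numAdv s t ≤ n}ᶜ := by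
    ext ω
    simp only [mem_ofPred_eq, mem_compl_iff, not_le]
    rw [← Nat.ceil_le, hn, Nat.succ_le_iff]
  rw [hset, ← ofReal_measureReal, probReal_compl_eq_one_sub (S.measurableSet_numAdv_le s t n)]
  refine ENNReal.ofReal_le_ofReal ?_
  have h1 := S.adv_bound s t hs hst n
  have h2 := one_sub_poisson_cdf_le hr hθ (n + 1)
  have h3 : c ≤ ((n + 1 : ℕ) : ℝ) := hn ▸ Nat.le_ceil c
  calc _ ≤ Real.exp (β * (t - s) * (Real.exp θ - 1) - θ * (n + 1 : ℕ)) := by linarith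
    _ ≤ _ := by
      rw [Real.exp_le_exp]
      have := mul_le_mul_of_nonneg_left h3 hθ
      linarith

end MiningSystem

/-! ### The probability of the typical event. -/

namespace MiningSystem

variable {Ω : Type*} [MeasurableSpace Ω] {P : Measure Ω} {α β Δ : ℝ}

/-- The event that the counts in `(a, a + ℓ]` are too small, or those in the slightly larger interval
`(a - 1, a + ℓ + 1] ∩ (0, ∞)` too large, for all intervals in between to be good. -/
def badEvent (S : MiningSystem P α β Δ) (δ a ℓ : ℝ) : Set Ω :=
  {ω | ((S.out ω).numHonest a (a + ℓ) : ℝ) ≤ (1 - δ) * (ℓ + 2) * α} ∪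
  {ω | (1 + δ) * ℓ * α ≤ (S.out ω).numHonest (max 0 (a - 1)) (a + ℓ + 1)} ∪
  {ω | ((S.out ω).numLagger Δ a (a + ℓ) : ℝ) ≤ (1 - δ) * (ℓ + 2) * discount α Δ * α} ∪
  {ω | ((S.out ω).numLoner Δ a (a + ℓ) : ℝ) ≤ (1 - δ) * (ℓ + 2) * discount α Δ ^ 2 * α} ∪
  {ω | ℓ * β + ℓ * discount α Δ ^ 2 * α * δ ≤ (S.out ω).numAdv (max 0 (a - 1)) (a + ℓ + 1)}

theorem goodEvent_of_notMem_badEvent (S : MiningSystem P α β Δ) {δ a ℓ a' b' : ℝ} (hα : 0 ≤ α)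
    (hβ : 0 ≤ β) (hδ : 0 ≤ δ) (hδ1 : δ ≤ 1) (ha' : 0 ≤ a') (h1 : a - 1 ≤ a') (h2 : a' ≤ a)
    (h3 : a + ℓ ≤ b') (h4 : b' ≤ a + ℓ + 1) {ω : Ω} (hω : ω ∉ S.badEvent δ a ℓ) :
    ω ∈ S.goodEvent δ a' b' := by
  simp only [badEvent, mem_union, mem_ofPred_eq, not_or, not_le] at hω
  obtain ⟨⟨⟨⟨hN, hN'⟩, hX⟩, hY⟩, hZ⟩ := hω
  have hg : 0 < discount α Δ := Real.exp_pos _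
  have hlow : ∀ (Q : ℕ → Prop), (({k | Q k ∧ (S.out ω).time k ∈ Ioc a (a + ℓ)}.ncard : ℕ) : ℝ) ≤
      ({k | Q k ∧ (S.out ω).time k ∈ Ioc a' b'}.ncard : ℕ) := fun Q => by
    exact_mod_cast (S.out ω).ncard_time_mem_mono Q h2 h3
  have hup : ∀ (Q : ℕ → Prop), (({k | Q k ∧ (S.out ω).time k ∈ Ioc a' b'}.ncard : ℕ) : ℝ) ≤
      ({k | Q k ∧ (S.out ω).time k ∈ Ioc (max 0 (a - 1)) (a + ℓ + 1)}.ncard : ℕ) := fun Q => by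
    exact_mod_cast (S.out ω).ncard_time_mem_mono Q (max_le ha' h1) h4
  have hlen : b' - a' ≤ ℓ + 2 := by linarith
  have hlen' : ℓ ≤ b' - a' := by linarith
  have h1δ : 0 ≤ 1 - δ := by linarith
  refine ⟨⟨⟨⟨?_, ?_⟩, ?_⟩, ?_⟩, ?_⟩
  · refine lt_of_le_of_lt ?_ (hN.trans_le (hlow _))
    gcongr
  · refine lt_of_le_of_lt (hup _) (hN'.trans_le ?_)
    gcongr
  · refine lt_of_le_of_lt ?_ (hX.trans_le (hlow _))
    gcongr
  · refine lt_of_le_of_lt ?_ (hY.trans_le (hlow _))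
    gcongr
  · refine lt_of_le_of_lt (hup _) (hZ.trans_le ?_)
    gcongr

theorem measure_badEvent_le [IsProbabilityMeasure P] (S : MiningSystem P α β Δ) {δ a ℓ : ℝ}
    (hα : 0 < α) (hβ : 0 ≤ β) (hΔ : 0 < Δ) (hδ : 0 < δ) (hδ' : δ < 40 / 81)
    (hαβ : β ≤ discount α Δ ^ 2 * α) (ha : 0 ≤ a) (hℓ : 78 ≤ ℓ * δ) :
    P (S.badEvent δ a ℓ) ≤
      ENNReal.ofReal (7 * Real.exp (-(1 / 27 * etaParam α Δ δ * ℓ))) := by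
  have hg : 0 < discount α Δ := Real.exp_pos _
  have hg1 : discount α Δ ≤ 1 := Real.exp_le_one_iff.2 (by simp; positivity)
  unfold etaParam
  set g := discount α Δ with hgdef
  have hg2 : g ^ 2 ≤ 1 := pow_le_one₀ hg.le hg1
  have hg2' : g ^ 2 ≤ g := by nlinarith
  have hℓ0 : 0 < ℓ := by
    by_contra! h
    nlinarith
  have hℓ1 : 1 ≤ ℓ := by nlinarith
  set θ := δ / 6 with hθdef
  have hθ : 0 < θ := by positivity
  have hθ1 : θ ≤ 1 / 12 := by linarith
  have hδθ : δ = 6 * θ := by rw [hθdef]; ring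
  -- Since `78 ≤ ℓ * δ`, the two extra units of length cost at most `ℓ * δ / 39`.
  have hlow : (1 - δ) * (ℓ + 2) ≤ ℓ * (1 - 38 / 39 * δ) := by nlinarith
  have hexp := Real.exp_bound_div_one_sub_of_interval' (x := θ) hθ (by linarith)
  have hexpθ : Real.exp θ - 1 ≤ θ * (1 + 2 * θ) := by
    have h1 : 1 / (1 - θ) ≤ 1 + θ * (1 + 2 * θ) := by
      rw [div_le_iff₀ (by linarith)]
      nlinarith [mul_nonneg (sq_nonneg θ) (by linarith : 0 ≤ 1 - 2 * θ)]
    linarith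
  have hexpθ0 : 0 ≤ Real.exp θ - 1 := by linarith [Real.add_one_le_exp θ]
  have hnegexp := (one_sub_exp_neg_bounds hθ.le (by linarith)).1
  have hup : (ℓ + 2) * (Real.exp θ - 1) ≤ θ * (ℓ * (1 + δ / 2)) := by
    calc (ℓ + 2) * (Real.exp θ - 1) ≤ (ℓ * (1 + δ / 39)) * (θ * (1 + 2 * θ)) := by
          refine mul_le_mul (by nlinarith) hexpθ hexpθ0 (by positivity)
      _ = θ * (ℓ * ((1 + δ / 39) * (1 + 2 * θ))) := by ring
      _ ≤ _ := by
          refine mul_le_mul_of_nonneg_left (mul_le_mul_of_nonneg_left ?_ hℓ0.le) hθ.le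
          nlinarith
  -- Each of the five exponents will be at most `-κ * α * ℓ * θ * (2 / 9 * δ)` with `κ` one of `1`,
  -- `g`, `g ^ 2`; with `θ = δ / 6` the constant is `2 / 54 = 1 / 27`.
  have hrate : ∀ κ, g ^ 2 ≤ κ → -(κ * α * ℓ * θ * (2 / 9 * δ)) ≤
      -(1 / 27 * (δ ^ 2 * g ^ 2 * α) * ℓ) := by
    intro κ hκ
    have h1 := mul_le_mul_of_nonneg_right hκ (by positivity : 0 ≤ α * ℓ * θ * (2 / 9 * δ))
    have h2 : 1 / 27 * (δ ^ 2 * g ^ 2 * α) * ℓ = g ^ 2 * (α * ℓ * θ * (2 / 9 * δ)) := by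
      rw [hθdef]; ring
    linarith
  have hN : P {ω | ((S.out ω).numHonest a (a + ℓ) : ℝ) ≤ (1 - δ) * (ℓ + 2) * α} ≤
      ENNReal.ofReal (Real.exp (-(1 / 27 * (δ ^ 2 * g ^ 2 * α) * ℓ))) := by
    refine (S.measure_numHonest_le hα.le ha (by linarith) hθ.le _).trans
      (ENNReal.ofReal_le_ofReal (Real.exp_le_exp.2 (le_trans ?_ (hrate 1 hg2))))
    have h1 := mul_le_mul_of_nonneg_left hnegexp (mul_pos hα hℓ0).le
    have h2 := mul_le_mul_of_nonneg_left hlow (mul_pos hθ hα).le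
    have h3 : 0 ≤ α * ℓ * θ * (38 / 39 * δ - θ / 2 - 2 / 9 * δ) :=
      mul_nonneg (by positivity) (by linarith)
    have e : a + ℓ - a = ℓ := by ring
    rw [e]
    linarith
  have hlen : a + ℓ + 1 - max 0 (a - 1) ≤ ℓ + 2 := by linarith [le_max_right 0 (a - 1)]
  have hlt : max 0 (a - 1) < a + ℓ + 1 := max_lt (by linarith) (by linarith)
  have hN' : P {ω | (1 + δ) * ℓ * α ≤ (S.out ω).numHonest (max 0 (a - 1)) (a + ℓ + 1)} ≤
      ENNReal.ofReal (Real.exp (-(1 / 27 * (δ ^ 2 * g ^ 2 * α) * ℓ))) := by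
    refine (S.measure_le_numHonest hα.le (le_max_left _ _) hlt hθ.le _).trans
      (ENNReal.ofReal_le_ofReal (Real.exp_le_exp.2 (le_trans ?_ (hrate 1 hg2))))
    have h1 : α * (a + ℓ + 1 - max 0 (a - 1)) * (Real.exp θ - 1) ≤
        α * ((ℓ + 2) * (Real.exp θ - 1)) := by
      rw [mul_assoc]
      gcongr
    have h2 := mul_le_mul_of_nonneg_left hup hα.le
    have h3 : 0 ≤ α * ℓ * θ * (δ / 2 - 2 / 9 * δ) := mul_nonneg (by positivity) (by linarith)
    linarith
  have hZ : P {ω | ℓ * β + ℓ * g ^ 2 * α * δ ≤ (S.out ω).numAdv (max 0 (a - 1)) (a + ℓ + 1)} ≤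
      ENNReal.ofReal (Real.exp (-(1 / 27 * (δ ^ 2 * g ^ 2 * α) * ℓ))) := by
    refine (S.measure_le_numAdv hβ (le_max_left _ _) hlt hθ.le _).trans
      (ENNReal.ofReal_le_ofReal (Real.exp_le_exp.2 (le_trans ?_ (hrate (g ^ 2) le_rfl))))
    have h1 : β * (a + ℓ + 1 - max 0 (a - 1)) * (Real.exp θ - 1) ≤
        β * ((ℓ + 2) * (Real.exp θ - 1)) := by
      rw [mul_assoc]
      gcongr
    have h2 := mul_le_mul_of_nonneg_left hup hβ
    have h3 := mul_le_mul_of_nonneg_right hαβ (by positivity : 0 ≤ θ * ℓ * (δ / 2))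
    have h4 : 0 ≤ g ^ 2 * α * ℓ * θ * (δ / 2 - 2 / 9 * δ) := mul_nonneg (by positivity) (by linarith)
    linarith
  have hXY : ∀ κ, g ^ 2 ≤ κ → θ * ((1 - δ) * (ℓ + 2) * κ * α) -
      κ * (θ * (1 - 2 * θ)) * (α * ℓ * (1 - θ)) ≤ -(1 / 27 * (δ ^ 2 * g ^ 2 * α) * ℓ) := by
    intro κ hκ
    refine le_trans ?_ (hrate κ hκ)
    have hκ0 : 0 ≤ κ := (sq_nonneg g).trans hκ
    have h1 := mul_le_mul_of_nonneg_left hlow (by positivity : 0 ≤ κ * α * θ)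
    have h2 : 0 ≤ κ * α * ℓ * θ * ((1 - 2 * θ) * (1 - θ) - (1 - 38 / 39 * δ) - 2 / 9 * δ) :=
      mul_nonneg (by positivity) (by nlinarith)
    linarith
  have hX : P {ω | ((S.out ω).numLagger Δ a (a + ℓ) : ℝ) ≤ (1 - δ) * (ℓ + 2) * g * α} ≤
      ENNReal.ofReal (2 * Real.exp (-(1 / 27 * (δ ^ 2 * g ^ 2 * α) * ℓ))) := by
    refine (S.measure_numLagger_le hα hΔ ha hℓ1 hθ hθ1 _).trans (ENNReal.ofReal_le_ofReal ?_)
    gcongr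
    exact hXY g hg2'
  have hY : P {ω | ((S.out ω).numLoner Δ a (a + ℓ) : ℝ) ≤ (1 - δ) * (ℓ + 2) * g ^ 2 * α} ≤
      ENNReal.ofReal (2 * Real.exp (-(1 / 27 * (δ ^ 2 * g ^ 2 * α) * ℓ))) := by
    refine (S.measure_numLoner_le hα hΔ ha hℓ1 hθ hθ1 _).trans (ENNReal.ofReal_le_ofReal ?_)
    gcongr
    exact hXY (g ^ 2) le_rfl
  set E := Real.exp (-(1 / 27 * (δ ^ 2 * g ^ 2 * α) * ℓ)) with hE
  have hE0 : 0 ≤ E := (Real.exp_pos _).le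
  have e : ENNReal.ofReal (7 * E) = ENNReal.ofReal E + ENNReal.ofReal E + ENNReal.ofReal (2 * E) +
      ENNReal.ofReal (2 * E) + ENNReal.ofReal E := by
    rw [← ENNReal.ofReal_add, ← ENNReal.ofReal_add, ← ENNReal.ofReal_add, ← ENNReal.ofReal_add]
    · ring_nf
    all_goals positivity
  rw [e]
  unfold badEvent
  refine (measure_union_le _ _).trans (add_le_add ?_ hZ)
  refine (measure_union_le _ _).trans (add_le_add ?_ hY)
  refine (measure_union_le _ _).trans (add_le_add ?_ hX)
  exact (measure_union_le _ _).trans (add_le_add hN hN')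

/-- The typical event has probability at least `1 - μ exp (-η (t - s) / 27)`. -/
theorem exists_measurableSet_subset_typicalEvent [IsProbabilityMeasure P]
    (S : MiningSystem P α β Δ) {δ s t : ℝ}
    (hα : 0 < α) (hβ : 0 ≤ β) (hΔ : 0 < Δ) (hδ : 0 < δ) (hδ' : δ < 40 / 81)
    (hαβ : β ≤ discount α Δ ^ 2 * α) (hℓ : 78 ≤ (t - s) * δ) :
    ∃ A : Set Ω, MeasurableSet A ∧
      1 - muParam α Δ δ * Real.exp (-(etaParam α Δ δ / 27 * (t - s))) ≤ P.real A ∧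
      A ⊆ S.typicalEvent δ s t := by
  set η := etaParam α Δ δ with hη
  have hη0 : 0 < η := by
    have hg : 0 < discount α Δ := Real.exp_pos _
    rw [hη]; unfold etaParam; positivity
  set x := Real.exp (-(1 / 27 * η)) with hx
  have hx0 : 0 < x := Real.exp_pos _
  have hx1 : x < 1 := Real.exp_lt_one_iff.2 (by linarith)
  set K := Real.exp (-(η / 27 * (t - s))) with hK
  have hK0 : 0 < K := Real.exp_pos _
  -- The cell `(i, j)` handles left endpoints in `[s - i - 1, s - i]` and right endpoints in `[t +
  -- j, t + j + 1]`; its bound carries the factor `x ^ i * x ^ j`.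
  set U : Set Ω := ⋃ (i : ℕ) (j : ℕ), if (i : ℝ) ≤ s then S.badEvent δ (s - i) (t - s + i + j) else ∅
    with hU
  have hmeasU : P U ≤ ENNReal.ofReal (7 * K / (1 - x) ^ 2) := by
    have hij : ∀ i j : ℕ,
        P (if (i : ℝ) ≤ s then S.badEvent δ (s - i) (t - s + i + j) else ∅) ≤
        ENNReal.ofReal (7 * K) * ENNReal.ofReal x ^ i * ENNReal.ofReal x ^ j := by
      intro i j
      split_ifs with hi
      · refine (S.measure_badEvent_le hα hβ hΔ hδ hδ' hαβ (by linarith) ?_).trans_eq ?_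
        · have : 0 ≤ ((i : ℝ) + j) * δ := by positivity
          linarith
        · rw [← ENNReal.ofReal_pow hx0.le, ← ENNReal.ofReal_pow hx0.le,
            ← ENNReal.ofReal_mul (by positivity), ← ENNReal.ofReal_mul (by positivity), hx,
            ← Real.exp_nat_mul, ← Real.exp_nat_mul, hK, mul_assoc 7, mul_assoc 7, ← Real.exp_add,
            ← Real.exp_add]
          congr 3
          ring
      · simp
    have hgeo : (1 - ENNReal.ofReal x)⁻¹ = ENNReal.ofReal (1 - x)⁻¹ := by
      rw [ENNReal.ofReal_inv_of_pos (by linarith), ENNReal.ofReal_sub _ hx0.le, ENNReal.ofReal_one]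
    calc P U ≤ ∑' i : ℕ, ∑' j : ℕ,
          ENNReal.ofReal (7 * K) * ENNReal.ofReal x ^ i * ENNReal.ofReal x ^ j :=
          (measure_iUnion_le _).trans (ENNReal.tsum_le_tsum fun i =>
            (measure_iUnion_le _).trans (ENNReal.tsum_le_tsum fun j => hij i j))
      _ = ENNReal.ofReal (7 * K) * (1 - ENNReal.ofReal x)⁻¹ * (1 - ENNReal.ofReal x)⁻¹ := by
          simp only [ENNReal.tsum_mul_left, ENNReal.tsum_mul_right, ENNReal.tsum_geometric]
      _ = _ := by
          rw [hgeo, ← ENNReal.ofReal_mul (by positivity),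
            ← ENNReal.ofReal_mul (mul_nonneg (by positivity) (inv_nonneg.2 (by linarith)))]
          congr 1
          field_simp
  -- The lagger and loner events have not been shown measurable, so `U` is replaced by a measurable
  -- hull of the same measure.
  refine ⟨(toMeasurable P U)ᶜ, (measurableSet_toMeasurable P U).compl, ?_, ?_⟩
  · rw [probReal_compl_eq_one_sub (measurableSet_toMeasurable P U), measureReal_def,
      measure_toMeasurable]
    have h1x : 0 < 1 - x := by linarith
    have h1 : (P U).toReal ≤ 7 * K / (1 - x) ^ 2 :=
      ENNReal.toReal_le_of_le_ofReal (by positivity) hmeasU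
    -- The constant `7` sums the prefactors `1, 1, 2, 2, 1` of the five tails and is below the `9`
    -- in `muParam`.
    have h2 : 7 * K / (1 - x) ^ 2 ≤ muParam α Δ δ * K := by
      unfold muParam
      rw [← hη, ← hx, div_mul_eq_mul_div]
      have h3 : 1 ≤ Real.exp (2 / 27 * η) := Real.one_le_exp (by positivity)
      gcongr
      linarith
    linarith
  · intro ω hω
    have hωU : ω ∉ U := fun h => hω (subset_toMeasurable P U h)
    simp only [typicalEvent, mem_iInter]
    intro a ha b hb
    have hi := Nat.floor_le (sub_nonneg.2 ha.2)
    have hi' := Nat.lt_floor_add_one (s - a)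
    have hj := Nat.floor_le (sub_nonneg.2 (show t ≤ b from hb))
    have hj' := Nat.lt_floor_add_one (b - t)
    set i := ⌊s - a⌋₊
    set j := ⌊b - t⌋₊
    have his : (i : ℝ) ≤ s := by linarith [ha.1]
    have hbad : ω ∉ S.badEvent δ (s - i) (t - s + i + j) := by
      intro h
      refine hωU (mem_iUnion₂.2 ⟨i, j, ?_⟩)
      rwa [if_pos his]
    refine S.goodEvent_of_notMem_badEvent hα.le hβ hδ.le (by linarith) ha.1 ?_ ?_ ?_ ?_ hbad <;>
      linarith

end MiningSystem

/-! ### The common prefix theorem. -/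

theorem mainTheorem1 {Ω : Type*} [MeasurableSpace Ω] (P : Measure Ω) [IsProbabilityMeasure P]
    (α β Δ δ : ℝ) (hα : 1 / 2 < α) (hβ : 0 ≤ β) (hΔ : 0 < Δ) (hδ : 0 < δ) (hδ' : δ < 40 / 81)
    (hαβ : β < (1 - 81 / 40 * δ) * discount α Δ ^ 2 * α)
    (S : MiningSystem P α β Δ) (k : ℕ) (t : ℝ)
    (hk : 160 * α * (1 + Δ) / δ ≤ k)
    (ht : k / ((1 - 41 / 40 * δ) * discount α Δ * α) ≤ t) :
    -- on the typical event, the `(k - 1)`-deep prefix of every `t`-credible blockchain exists and is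
    -- extended by all `r`-credible blockchains with `r ≥ t`
    (∀ ω ∈ S.typicalEvent δ (t - k / (2 * α) + Δ) (t - Δ),
      ∀ b, (S.out ω).Credible Δ t b →
        k - 1 ≤ (S.out ω).height b ∧
        ∀ r, t ≤ r → ∀ d, (S.out ω).Credible Δ r d →
          (S.out ω).deepPrefix (k - 1) b <+: (S.out ω).chain d) ∧
    -- with the asserted probability, that prefix is permanent after `t`
    ∃ A : Set Ω, MeasurableSet A ∧
      1 - muParam α Δ δ *
          Real.exp (-(etaParam α Δ δ / 27 * (k / (2 * α) - 2 * Δ))) ≤ P.real A ∧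
      ∀ ω ∈ A, ∀ b, (S.out ω).Credible Δ t b →
        k - 1 ≤ (S.out ω).height b ∧
        (S.out ω).PermanentAfter Δ t ((S.out ω).deepPrefix (k - 1) b) := by
  have hα0 : 0 < α := by linarith
  have hg : 0 < discount α Δ := Real.exp_pos _
  have hg1 : discount α Δ ≤ 1 := Real.exp_le_one_iff.2 (by simp; positivity)
  have hdet : ∀ ω ∈ S.typicalEvent δ (t - k / (2 * α) + Δ) (t - Δ),
      ∀ b, (S.out ω).Credible Δ t b →
        k - 1 ≤ (S.out ω).height b ∧
        ∀ r, t ≤ r → ∀ d, (S.out ω).Credible Δ r d →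
          (S.out ω).deepPrefix (k - 1) b <+: (S.out ω).chain d := by
    intro ω hω b hb
    simp only [MiningSystem.typicalEvent, mem_iInter] at hω
    refine (S.follows ω).common_prefix hα0 hβ hΔ hδ hδ' hg hg1 hαβ hk ht (fun a ha c hc => ?_) hb
    obtain ⟨⟨⟨h1, h2⟩, h3⟩, h4⟩ := hω a ha c hc
    exact ⟨h1.2, h2, h3, h4⟩
  refine ⟨hdet, ?_⟩
  have hw : 80 * (1 + Δ) ≤ k / (2 * α) * δ := by
    rw [div_le_iff₀ hδ] at hk
    rw [div_mul_eq_mul_div, le_div_iff₀ (by positivity)]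
    linarith
  have hβ' : β ≤ discount α Δ ^ 2 * α := by
    refine hαβ.le.trans ?_
    rw [mul_assoc]
    exact mul_le_of_le_one_left (by positivity) (by linarith)
  have e : t - Δ - (t - k / (2 * α) + Δ) = k / (2 * α) - 2 * Δ := by ring
  -- The length condition holds because `(k / (2 * α) - 2 * Δ) * δ ≥ 80 * (1 + Δ) - 2 * Δ * δ ≥ 78`.
  obtain ⟨A, hA, hPA, hsub⟩ := S.exists_measurableSet_subset_typicalEvent hα0 hβ hΔ hδ hδ' hβ'
    (s := t - k / (2 * α) + Δ) (t := t - Δ) (by rw [e]; nlinarith)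
  rw [e] at hPA
  exact ⟨A, hA, hPA, fun ω hω b hb => hdet ω (hsub hω) b hb⟩
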